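/- Definitions. Let $G\leq \mathrm{O}(d)$. Equip the orbit space $\mathbb{R}^d/G$ with $d(G\cdot x,G\cdot y):=\inf_{p\in G\cdot x,\,q\in G\cdot y}\|p-q\|$ and put $\langle\!\langle G\cdot x,G\cdot y\rangle\!\rangle:=\sup_{p\in G\cdot x,\,q\in G\cdot y}\langle p,q\rangle$. The max filter bank with templates $t_1,\dots,t_n\in\mathbb{R}^d$ is the map $\Phi\colon\mathbb{R}^d/G\to\mathbb{R}^n$, $\Phi(G\cdot x):=(\langle\!\langle G\cdot t_i,G\cdot x\rangle\!\rangle)_{i=1}^n$. The optimal max filtering condition number $\kappa(G)$ is the infimum of the quotients $C/c$, over $c>0$ and $C\ge 0$ for which there exist $n\in\mathbb{N}$ and templates $t_1,\dots,t_n$ such that $$c\,d(u,v)\le\|\Phi(u)-\Phi(v)\|\le C\,d(u,v)\qquad\text{for all }u,v\in\mathbb{R}^d/G.$$ For a Coxeter matrix $(m_{ij})_{i,j=1}^d$ of one of the types below, let $\alpha_1,\dots,\alpha_d\in\mathbb{R}^d$ be vectors with $\langle\alpha_i,\alpha_j\rangle=-\cos(\pi/m_{ij})$ for all $i,j$ (so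 that each $\alpha_i$ is a unit vector). The corresponding standard reflection group is the subgroup of $\mathrm{O}(d)$ generated by the reflections in the hyperplanes $\alpha_i^\perp$. We write $\kappa(A_\ell)$, $\kappa(E_6)$, etc. for the optimal max filtering condition number of the standard reflection group of that type. The type $I_m$ has two generators and $m_{12}=m$. Theorem. For every type below, such vectors $\alpha_1,\dots,\alpha_d$ exist, and $\kappa$ does not depend on their choice. The values of $\kappa$ for the exceptional types are the following, where each decimal value is accurate to within an error less than $10^{-4}$ and the polynomial is the minimal polynomial of $\kappa$ over $\mathbb{Q}$: - $\kappa(E_6)\approx 7.5957$, with $x^4-8x^3+2x^2+8x+1$; - $\kappa(E_7)\approx 11.4301$, with $x^6-12x^5+3x^4+40x^3+3x^2-12x+1$; - $\kappa(E_8)\approx 19.0811$, with $x^8-16x^7-60x^6+16x^5+134x^4+16x^3-60x^2-16x+1$; - $\kappa(F_4)\approx 7.5957$, with $x^4-8x^3+2x^2+8x+1$; - $\kappa(H_3)\approx 6.3137$, with $x^4-4x^3-14x^2-4x+1$; - $\kappa(H_4)\approx 19.0811$, with $x^8-16x^7-60x^6+16x^5+134x^4+16x^3-60x^2-16x+1$.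 For the remaining irreducible finite types $A_\ell$ ($\ell\ge1$), $B_\ell$ ($\ell\ge2$), $D_\ell$ ($\ell\ge4$) and $I_m$ ($m\ge3$), (a) $\kappa(A_\ell)=(\frac{2}{\pi}+o(1))\,\ell$ as $\ell\to\infty$, (b) $\kappa(B_\ell)=(\frac{4}{\pi}+o(1))\,\ell$ as $\ell\to\infty$, (c) $\kappa(D_\ell)=(\frac{4}{\pi}+o(1))\,\ell$ as $\ell\to\infty$, and (d) $\kappa(I_m)=\sqrt{\frac{1+\cos(\pi/m)}{1-\cos(\pi/m)}}$ for every $m\ge3$, and this equals $(\frac{2}{\pi}+o(1))\,m$ as $m\to\infty$. -/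

import Mathlib

open Polynomial Filter Topology

namespace MaxFilter

noncomputable section

/-- The orthogonal group `O(V)` acts on `V` by evaluation; subgroups inherit this action. -/
instance instMulActionO (V : Type*) [NormedAddCommGroup V] [InnerProductSpace ℝ V] :
    MulAction (V ≃ₗᵢ[ℝ] V) V where
  smul g x := g x
  one_smul _ := rfl
  mul_smul _ _ _ := rfl

section Orbits

variable {V : Type*} [NormedAddCommGroup V] [InnerProductSpace ℝ V]

/-- The orbit space `V / G` of a group `G ≤ O(V)`. -/
abbrev OrbitSpace (G : Subgroup (V ≃ₗᵢ[ℝ] V)) : Type _ := MulAction.orbitRel.Quotient G V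

/-- The orbit `G · x` as a point of `V / G`. -/
def orbitMk (G : Subgroup (V ≃ₗᵢ[ℝ] V)) (x : V) : OrbitSpace G := Quotient.mk'' x

/-- The quotient Euclidean metric: the infimum of the distances between points of two orbits. -/
def orbitDist {G : Subgroup (V ≃ₗᵢ[ℝ] V)} (x y : OrbitSpace G) : ℝ :=
  ⨅ p : x.orbit × y.orbit, dist (p.1 : V) (p.2 : V)

/-- The max filtering map: the supremum of the inner products of points of two orbits. -/
def maxFilter {G : Subgroup (V ≃ₗᵢ[ℝ] V)} (x y : OrbitSpace G) : ℝ :=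
  ⨆ p : x.orbit × y.orbit, inner ℝ (p.1 : V) (p.2 : V)

/-- The max filter bank `V / G → ℝⁿ` with templates `t₁, …, tₙ`. -/
def filterBank (G : Subgroup (V ≃ₗᵢ[ℝ] V)) {n : ℕ} (t : Fin n → V) (x : OrbitSpace G) :
    EuclideanSpace ℝ (Fin n) :=
  WithLp.toLp 2 fun i => maxFilter (orbitMk G (t i)) x

/-- `c` and `C` are lower and upper Lipschitz bounds of the max filter bank with templates `t`. -/
def HasLipschitzBounds (G : Subgroup (V ≃ₗᵢ[ℝ] V)) {n : ℕ} (t : Fin n → V) (c C : ℝ) : Prop :=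
  0 < c ∧ 0 ≤ C ∧ ∀ x y : OrbitSpace G,
    c * orbitDist x y ≤ dist (filterBank G t x) (filterBank G t y) ∧
      dist (filterBank G t x) (filterBank G t y) ≤ C * orbitDist x y

/-- The optimal max filtering condition number `κ(G)`. -/
def kappa (G : Subgroup (V ≃ₗᵢ[ℝ] V)) : ℝ :=
  sInf {r : ℝ | ∃ (n : ℕ) (t : Fin n → V) (c C : ℝ), HasLipschitzBounds G t c C ∧ r = C / c}

end Orbits

/-- `G ≤ O(d)` is (a copy of) the reflection group with Coxeter matrix `M`: it is generated by the
reflections in the hyperplanes orthogonal to `α₁, …, α_d`, where `⟪αᵢ, αⱼ⟫ = -cos (π / mᵢⱼ)`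
(for `i = j` this says that `αᵢ` is a unit vector, because `mᵢᵢ = 1`). -/
def IsStandardGroup {d : ℕ} (M : CoxeterMatrix (Fin d))
    (G : Subgroup (EuclideanSpace ℝ (Fin d) ≃ₗᵢ[ℝ] EuclideanSpace ℝ (Fin d))) : Prop :=
  ∃ α : Fin d → EuclideanSpace ℝ (Fin d),
    (∀ i j, inner ℝ (α i) (α j) = -Real.cos (Real.pi / (M i j : ℝ))) ∧
      G = Subgroup.closure
        (Set.range fun i => ((Submodule.span ℝ {α i})ᗮ.reflection :
          EuclideanSpace ℝ (Fin d) ≃ₗᵢ[ℝ] EuclideanSpace ℝ (Fin d)))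

/-- `κ` of the Coxeter group with Coxeter matrix `M` equals `r`: the standard reflection group
exists in `O(d)`, and each copy of it has `κ = r`. -/
def KappaEq {d : ℕ} (M : CoxeterMatrix (Fin d)) (r : ℝ) : Prop :=
  (∃ G, IsStandardGroup M G) ∧ ∀ G, IsStandardGroup M G → kappa G = r

/-- The Coxeter matrix of type `D_ℓ`: on the nodes `0, …, ℓ - 1`, the diagram has the edges
`0 — 1 — ⋯ — (ℓ - 2)` and `(ℓ - 3) — (ℓ - 1)`. (In Mathlib's `CoxeterMatrix.D` the nodes `ℓ - 2`
and `ℓ - 1` are also joined, so that its diagram contains a triangle.) -/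
def coxeterD (l : ℕ) : CoxeterMatrix (Fin l) where
  M := Matrix.of fun i j : Fin l =>
    if i = j then 1
    else if ((i : ℕ) + 1 = j ∧ (j : ℕ) + 1 < l) ∨ ((j : ℕ) + 1 = i ∧ (i : ℕ) + 1 < l) ∨
        ((i : ℕ) + 2 = j ∧ (j : ℕ) + 1 = l) ∨ ((j : ℕ) + 2 = i ∧ (i : ℕ) + 1 = l) then 3
    else 2
  isSymm := by
    ext i j
    simp only [Matrix.transpose_apply, Matrix.of_apply]
    grind
  diagonal := by simp
  off_diagonal := by
    intro i j h
    simp only [Matrix.of_apply, if_neg h]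
    split_ifs <;> decide

/-- The Coxeter matrix of type `I_m` (two generators whose product has order `m`), for `m ≥ 2`.
Mathlib's `CoxeterMatrix.I k` has the label `k + 2`. -/
def coxeterI (m : ℕ) : CoxeterMatrix (Fin 2) := CoxeterMatrix.I (m - 2)

end

end MaxFilter

/-! Every orbit closure meets the closed chamber of the simple roots, and on chamber points the
identity is the optimal group element: `inner ℝ (w x) y ≤ inner ℝ x y` for `x`, `y` in the chamber
(`IsCoxeterBasis.inner_apply_le`). So the orbit distance is the Euclidean distance of chamber
representatives, max filtering is their inner product, and a filter bank becomes the restriction to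
the chamber of the linear map `z ↦ (⟪tₖ, z⟫)` with every `tₖ` in the chamber. Any vector is a
difference of two chamber points, so Lipschitz bounds are exactly frame bounds for the `tₖ`.

The Gram matrix of the roots is `1 - N` with `N` nonnegative. Let `v` be a positive eigenvector of
`N` with eigenvalue `k < 1`, and let `ε` be the signs of a two-colouring of the diagram. Then `∑ vᵢ
αᵢ` and `∑ εᵢ vᵢ αᵢ` have squared norms proportional to `1 - k` and `1 + k`. Chamber templates pair
nonnegatively with each root, so the analysis map is at least as large on the shorter vector as on
the longer one, whence `C / c ≥ √((1 + k) / (1 - k))`. The basis dual to the roots attains this,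
because `1 - N` has spectrum in `[1 - k, 1 + k]`.

It remains to exhibit `v`. In each type `k = cos (π / h)` with `h` the Coxeter number, so `κ = cot
(π / (2h))`. The families have sine vectors and the exceptional types have Chebyshev values along
the arms of the diagram. Minimality of the polynomials comes from `(κ + i) / (κ - i)`, a primitive
root of unity of order `2h`: it has degree `φ(2h)` and lies in `ℚ(κ, i)`. -/

namespace MaxFilter

/-! ### Word length with respect to a set of involutions -/

section WordLength

variable {H ι : Type*} [Group H]

/-- The least length of a word in the generators `s` that represents `w`. -/
noncomputable def wordLength (s : ι → H) (w : H) : ℕ :=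
  sInf {n | ∃ l : List ι, (l.map s).prod = w ∧ l.length = n}

/-- `w` is represented by a word in the generators `s`. -/
def IsWord (s : ι → H) (w : H) : Prop := ∃ l : List ι, (l.map s).prod = w

theorem wordLength_le (s : ι → H) (l : List ι) : wordLength s (l.map s).prod ≤ l.length :=
  Nat.sInf_le ⟨l, rfl, rfl⟩

/-- An element that is not a word gets length `sInf ∅ = 0`, so the length estimates below carry
`IsWord` hypotheses. -/
theorem IsWord.exists_reduced {s : ι → H} {w : H} (h : IsWord s w) :
    ∃ l : List ι, (l.map s).prod = w ∧ l.length = wordLength s w := by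
  obtain ⟨l, hl⟩ := h
  exact Nat.sInf_mem (s := {n | ∃ l : List ι, (l.map s).prod = w ∧ l.length = n})
    ⟨l.length, l, hl, rfl⟩

theorem isWord_one (s : ι → H) : IsWord s 1 := ⟨[], rfl⟩

theorem IsWord.mul {s : ι → H} {w w' : H} (h : IsWord s w) (h' : IsWord s w') :
    IsWord s (w * w') := by
  obtain ⟨l, rfl⟩ := h
  obtain ⟨l', rfl⟩ := h'
  exact ⟨l ++ l', by simp⟩

theorem isWord_generator (s : ι → H) (i : ι) : IsWord s (s i) := ⟨[i], by simp⟩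

theorem wordLength_mul_le {s : ι → H} {w w' : H} (h : IsWord s w) (h' : IsWord s w') :
    wordLength s (w * w') ≤ wordLength s w + wordLength s w' := by
  obtain ⟨l, rfl, hl⟩ := h.exists_reduced
  obtain ⟨l', rfl, hl'⟩ := h'.exists_reduced
  rw [← hl, ← hl', ← List.length_append, ← List.prod_append, ← List.map_append]
  exact wordLength_le _ _

theorem wordLength_generator_le (s : ι → H) (i : ι) : wordLength s (s i) ≤ 1 := by
  simpa using wordLength_le s [i]

theorem IsWord.exists_descent {s : ι → H} (hs : ∀ i, s i * s i = 1) {w : H} (h : IsWord s w)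
    (hw : w ≠ 1) : ∃ i, wordLength s (w * s i) < wordLength s w := by
  obtain ⟨l, rfl, hl⟩ := h.exists_reduced
  rcases List.eq_nil_or_concat' l with rfl | ⟨l', i, rfl⟩
  · simp at hw
  · refine ⟨i, ?_⟩
    rw [← hl]
    have : ((l' ++ [i]).map s).prod * s i = (l'.map s).prod := by
      simp [mul_assoc, hs]
    rw [this]
    exact (wordLength_le s l').trans_lt (by simp)

theorem isWord_of_mem_closure {s : ι → H} (hs : ∀ i, s i * s i = 1) {w : H}
    (hw : w ∈ Subgroup.closure (Set.range s)) : IsWord s w := by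
  induction hw using Subgroup.closure_induction_right with
  | one => exact isWord_one s
  | mul_right x _ y hy ih =>
    obtain ⟨i, rfl⟩ := hy
    exact ih.mul (isWord_generator s i)
  | mul_inv_cancel x _ y hy ih =>
    obtain ⟨i, rfl⟩ := hy
    rw [inv_eq_of_mul_eq_one_left (hs i)]
    exact ih.mul (isWord_generator s i)

/-- The letters `j, i, j, i, …`. -/
def altLetter (i j : ι) (k : ℕ) : ι := if Even k then j else i

/-- The alternating word of length `k` whose last letter is `j`. -/
def altWord (s : ι → H) (i j : ι) : ℕ → H
  | 0 => 1
  | k + 1 => s (altLetter i j k) * altWord s i j k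

theorem isWord_altWord (s : ι → H) (i j : ι) (k : ℕ) : IsWord s (altWord s i j k) := by
  induction k with
  | zero => exact isWord_one s
  | succ k ih => exact (isWord_generator s _).mul ih

theorem wordLength_altWord_le (s : ι → H) (i j : ι) (k : ℕ) :
    wordLength s (altWord s i j k) ≤ k := by
  induction k with
  | zero => simpa [altWord] using wordLength_le s []
  | succ k ih =>
    refine (wordLength_mul_le (isWord_generator s _) (isWord_altWord s i j k)).trans ?_
    have := wordLength_generator_le s (altLetter i j k)
    omega

theorem altLetter_add_two (i j : ι) (k : ℕ) : altLetter i j (k + 2) = altLetter i j k := by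
  simp [altLetter, Nat.even_add]

theorem isWord_altWord_inv {s : ι → H} (hs : ∀ i, s i * s i = 1) (i j : ι) (k : ℕ) :
    IsWord s (altWord s i j k)⁻¹ := by
  induction k with
  | zero => simpa [altWord] using isWord_one s
  | succ k ih =>
    rw [altWord, mul_inv_rev, inv_eq_of_mul_eq_one_left (hs _)]
    exact ih.mul (isWord_generator s _)

end WordLength

/-! ### Reflections, lengths and positivity of roots -/

section Reflections

variable {V ι : Type*} [NormedAddCommGroup V] [InnerProductSpace ℝ V]

/-- The reflections in the hyperplanes orthogonal to the vectors `α i`. -/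
noncomputable def simpleReflection (α : ι → V) (i : ι) : V ≃ₗᵢ[ℝ] V :=
  (Submodule.span ℝ {α i})ᗮ.reflection

/-- Unit vectors whose Gram matrix is `(-cos (π / mᵢⱼ))`. -/
structure IsCoxeterBasis (m : ι → ι → ℕ) (α : ι → V) : Prop where
  inner_self : ∀ i, inner ℝ (α i) (α i) = 1
  inner_ne : ∀ i j, i ≠ j → inner ℝ (α i) (α j) = -Real.cos (Real.pi / m i j)
  two_le : ∀ i j, i ≠ j → 2 ≤ m i j

theorem simpleReflection_apply {α : ι → V} {i : ι} (h : inner ℝ (α i) (α i) = 1) (x : V) :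
    simpleReflection α i x = x - (2 * inner ℝ (α i) x) • α i := by
  rw [simpleReflection, Submodule.reflection_orthogonal_apply, Submodule.reflection_singleton_apply]
  rw [real_inner_self_eq_norm_sq] at h
  simp [h, two_smul, two_mul, add_smul]

theorem simpleReflection_mul_self (α : ι → V) (i : ι) :
    simpleReflection α i * simpleReflection α i = 1 :=
  Submodule.reflection_mul_reflection _

/-- The roots of the dihedral subgroup generated by the reflections `i`, `j` have coordinates `sin
(kθ) / sin θ`, by the recurrence for `sin (kθ)`. The factor `sin θ` is kept on the left to avoid
division. -/
theorem IsCoxeterBasis.altWord_apply {m : ι → ι → ℕ} {α : ι → V} (hα : IsCoxeterBasis m α)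
    {i j : ι} (hij : i ≠ j) (k : ℕ) :
    Real.sin (Real.pi / m i j) • altWord (simpleReflection α) i j k (α i) =
      Real.sin ((k + 1) * (Real.pi / m i j)) • α (altLetter i j (k + 1)) +
        Real.sin (k * (Real.pi / m i j)) • α (altLetter i j k) := by
  set θ := Real.pi / m i j with hθ
  induction k with
  | zero => simp [altWord, altLetter]
  | succ k ih =>
    have hinner : inner ℝ (α (altLetter i j k)) (α (altLetter i j (k + 1))) = -Real.cos θ := by
      by_cases hk : Even k
      · simp only [altLetter, hk, Nat.even_add_one, if_true, not_true, if_false]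
        rw [real_inner_comm, hα.inner_ne i j hij]
      · simp only [altLetter, hk, Nat.even_add_one, if_true, not_false_iff, if_false]
        rw [hα.inner_ne i j hij]
    have hmul : altWord (simpleReflection α) i j (k + 1) (α i) =
        simpleReflection α (altLetter i j k) (altWord (simpleReflection α) i j k (α i)) := rfl
    rw [hmul, ← map_smul, ih, simpleReflection_apply (hα.inner_self _), inner_add_right,
      inner_smul_right, inner_smul_right, hinner, hα.inner_self, altLetter_add_two]
    have hsin : Real.sin ((((k + 1 : ℕ) : ℝ) + 1) * θ) =
        2 * Real.cos θ * Real.sin ((k + 1) * θ) - Real.sin (k * θ) := by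
      have h1 : (((k + 1 : ℕ) : ℝ) + 1) * θ = (k + 1) * θ + θ := by push_cast; ring
      have h2 : (k : ℝ) * θ = (k + 1) * θ - θ := by ring
      rw [h1, h2, Real.sin_add, Real.sin_sub]
      ring
    rw [hsin]
    push_cast
    module

theorem simpleReflection_conj {α : ι → V} (h : ∀ i, inner ℝ (α i) (α i) = 1)
    (w : V ≃ₗᵢ[ℝ] V) {i j : ι} (hw : w (α i) = -α j) :
    w * simpleReflection α i = simpleReflection α j * w := by
  ext x
  change w (simpleReflection α i x) = simpleReflection α j (w x)
  rw [simpleReflection_apply (h i), simpleReflection_apply (h j), map_sub, map_smul, hw,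
    ← w.inner_map_map (α i) x, hw, inner_neg_left]
  module

/-- This is the classical fact that `w` sends `αᵢ` to a positive root unless `sᵢ` shortens `w`,
tested against a chamber point. Choose a descent `j` of `w` and split off a dihedral factor, `w = v
u`, so that `v` is shorter than `w` and neither `sᵢ` nor `sⱼ` shortens `v`. Then `u αᵢ` is a
nonnegative combination of `αᵢ` and `αⱼ`, and induction applies to `v`. -/
theorem IsCoxeterBasis.inner_apply_nonneg {m : ι → ι → ℕ} {α : ι → V} (hα : IsCoxeterBasis m α)
    {y : V} (hy : ∀ i, 0 ≤ inner ℝ (α i) y) {w : V ≃ₗᵢ[ℝ] V}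
    (hw : IsWord (simpleReflection α) w) {i : ι}
    (hi : wordLength (simpleReflection α) w ≤
      wordLength (simpleReflection α) (w * simpleReflection α i)) :
    0 ≤ inner ℝ (w (α i)) y := by
  set s := simpleReflection α with hs
  have hss : ∀ i, s i * s i = 1 := simpleReflection_mul_self α
  induction hn : wordLength s w using Nat.strong_induction_on generalizing w i with
  | _ n IH =>
  by_cases hw1 : w = 1
  · subst hw1
    exact hy i
  obtain ⟨j, hj⟩ := hw.exists_descent hss hw1
  have hij : i ≠ j := by rintro rfl; omega
  set M := m i j with hM
  have hM2 : 2 ≤ M := hα.two_le i j hij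
  have hMR : (2 : ℝ) ≤ M := by exact_mod_cast hM2
  set θ := Real.pi / M with hθ
  have hθM : M * θ = Real.pi := by rw [hθ]; field_simp
  have hθ0 : 0 < θ := by positivity
  have hsin : 0 < Real.sin θ := Real.sin_pos_of_pos_of_lt_pi hθ0 (by nlinarith)
  obtain ⟨u, hu⟩ : ∃ u, u = altWord s i j := ⟨_, rfl⟩
  obtain ⟨v, hvw, hvu, hvs⟩ : ∃ v : ℕ → (V ≃ₗᵢ[ℝ] V), (∀ k, IsWord s (v k)) ∧
      (∀ k, v k * u k = w) ∧ ∀ k, v (k + 1) = v k * s (altLetter i j k) := by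
    refine ⟨fun k => w * (u k)⁻¹, fun k => ?_, fun k => by simp, fun k => ?_⟩
    · rw [hu]
      exact hw.mul (isWord_altWord_inv hss i j k)
    · simp only [hu, altWord, mul_inv_rev, inv_eq_of_mul_eq_one_left (hss _), mul_assoc]
  -- Splitting off `u k` cannot stay length-additive up to `k = M`: the alternating word of length
  -- `M` satisfies `u M * s i = u (M - 1)`, so `w * s i` would be shorter than `w`.
  have hex : ∃ k, k ≤ M ∧ wordLength s w < wordLength s (v k) + k := by
    by_contra! hcon
    have h1 := hcon M le_rfl
    have hua : altWord s i j M (α i) = -α (altLetter i j (M + 1)) := by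
      have := hα.altWord_apply hij M
      rw [← hM, ← hθ, add_mul, one_mul, hθM, Real.sin_pi, zero_smul, add_zero,
        add_comm Real.pi, Real.sin_add_pi, neg_smul, ← smul_neg] at this
      exact smul_right_injective _ hsin.ne' this
    have hM1 : M - 1 + 1 = M := by omega
    have hM1' : M + 1 = M - 1 + 2 := by omega
    have hconj : u M * s i = u (M - 1) := by
      rw [hu, simpleReflection_conj hα.inner_self _ hua, ← hs, hM1', altLetter_add_two]
      conv_lhs => rw [← hM1]
      rw [altWord, ← mul_assoc, hM1, hss, one_mul]
    have hws : w * s i = v M * u (M - 1) := by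
      rw [← hvu M, mul_assoc, hconj]
    have h2 := wordLength_mul_le (hvw M) (isWord_altWord s i j (M - 1))
    have h3 := wordLength_altWord_le s i j (M - 1)
    rw [← hu] at h2 h3
    rw [hws] at hi
    omega
  classical
  obtain ⟨hKM, hK⟩ := Nat.find_spec hex
  -- `K` is the first failure of additivity. It is at least 2 because `j` is a descent, and `v (K -
  -- 1)` is the factor to which induction applies.
  set K := Nat.find hex with hKdef
  have hmin : ∀ k, k < K → wordLength s (v k) + k ≤ wordLength s w := fun k hk => by
    have := Nat.find_min hex hk
    push Not at this
    exact this (hk.le.trans hKM)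
  have hlow : ∀ k, wordLength s w ≤ wordLength s (v k) + k := fun k => by
    have h2 := wordLength_mul_le (hvw k) (isWord_altWord s i j k)
    have h3 := wordLength_altWord_le s i j k
    rw [← hu] at h2 h3
    rw [hvu] at h2
    omega
  have hv0 : v 0 = w := by simpa [hu, altWord] using hvu 0
  have hv1 : v 1 = w * s j := by rw [hvs 0, hv0]; simp [altLetter]
  have hK2 : 2 ≤ K := by
    rcases hK' : K with _ | _ | k
    · rw [hK', hv0] at hK; omega
    · rw [hK', zero_add, hv1] at hK; omega
    · omega
  obtain ⟨k, hk⟩ : ∃ k, K = k + 2 := ⟨K - 2, by omega⟩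
  rw [hk] at hK hKM hmin
  have e1 := hmin (k + 1) (by omega)
  have e0 := hmin k (by omega)
  have l0 := hlow k
  have l1 := hlow (k + 1)
  -- One of the two letters leads from `v (k + 1)` on to `v (k + 2)`, which is no shorter by the
  -- choice of `K`. The other leads back to `v k`, which is longer by one.
  have hb : 0 ≤ inner ℝ (v (k + 1) (α (altLetter i j (k + 1)))) y := by
    refine IH _ ?_ (hvw (k + 1)) ?_ rfl
    · omega
    · rw [← hvs, show k + 1 + 1 = k + 2 from rfl]; omega
  have ha : 0 ≤ inner ℝ (v (k + 1) (α (altLetter i j k))) y := by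
    refine IH _ ?_ (hvw (k + 1)) ?_ rfl
    · omega
    · rw [hvs k, mul_assoc, hss, mul_one, ← hvs]; omega
  have hform := congrArg (fun z => inner ℝ (v (k + 1) z) y) (hα.altWord_apply hij (k + 1))
  simp only [map_smul, map_add, inner_add_left, inner_smul_left, altLetter_add_two] at hform
  have hwa : v (k + 1) (altWord (simpleReflection α) i j (k + 1) (α i)) = w (α i) := by
    rw [← hvu (k + 1), hu]; rfl
  rw [hwa, ← hM, ← hθ] at hform
  have hkM : ((k : ℝ) + 2) ≤ M := by exact_mod_cast hKM
  -- Both angles are at most `π` because `K = k + 2 ≤ M`.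
  have s1 : 0 ≤ Real.sin ((((k + 1 : ℕ) : ℝ) + 1) * θ) := by
    apply Real.sin_nonneg_of_nonneg_of_le_pi (by positivity)
    rw [← hθM]; push_cast; nlinarith
  have s2 : 0 ≤ Real.sin (((k + 1 : ℕ) : ℝ) * θ) := by
    apply Real.sin_nonneg_of_nonneg_of_le_pi (by positivity)
    rw [← hθM]; push_cast; nlinarith
  have := add_nonneg (mul_nonneg s1 ha) (mul_nonneg s2 hb)
  simp only [conj_trivial] at hform
  rw [← hform] at this
  exact nonneg_of_mul_nonneg_right this hsin

/-- Removing a descent, `w = w' sⱼ`, changes the inner product by `2 ⟪αⱼ, x⟫ ⟪w' αⱼ, y⟫`, a product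
of nonnegative factors by the previous theorem. -/
theorem IsCoxeterBasis.inner_apply_le {m : ι → ι → ℕ} {α : ι → V} (hα : IsCoxeterBasis m α)
    {x y : V} (hx : ∀ i, 0 ≤ inner ℝ (α i) x) (hy : ∀ i, 0 ≤ inner ℝ (α i) y) {w : V ≃ₗᵢ[ℝ] V}
    (hw : IsWord (simpleReflection α) w) : inner ℝ (w x) y ≤ inner ℝ x y := by
  have hss : ∀ i, simpleReflection α i * simpleReflection α i = 1 := simpleReflection_mul_self α
  induction hn : wordLength (simpleReflection α) w using Nat.strong_induction_on
    generalizing w with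
  | _ n IH =>
  by_cases hw1 : w = 1
  · subst hw1
    exact le_rfl
  obtain ⟨j, hj⟩ := hw.exists_descent hss hw1
  have hw' := hw.mul (isWord_generator (simpleReflection α) j)
  set w' := w * simpleReflection α j with hw'def
  have hww : w = w' * simpleReflection α j := by rw [hw'def, mul_assoc, hss, mul_one]
  have h1 := hα.inner_apply_nonneg hy hw' (i := j) (by rw [← hww]; exact hj.le)
  have h2 := IH _ (hn ▸ hj) hw' rfl
  have h3 : w x = w' x - (2 * inner ℝ (α j) x) • w' (α j) := by
    rw [hww]
    change w' (simpleReflection α j x) = _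
    rw [simpleReflection_apply (hα.inner_self j), map_sub, map_smul]
  rw [h3, inner_sub_left, inner_smul_left]
  simp only [conj_trivial]
  nlinarith [hx j, mul_nonneg (hx j) h1]

end Reflections

/-! ### The closed chamber as a model of the orbit space -/

section Chamber

variable {V : Type*} [NormedAddCommGroup V] [InnerProductSpace ℝ V]

theorem mem_orbit_orbitMk {G : Subgroup (V ≃ₗᵢ[ℝ] V)} {x p : V} :
    p ∈ (orbitMk G x).orbit ↔ ∃ g ∈ G, g x = p := by
  rw [orbitMk, MulAction.orbitRel.Quotient.orbit_mk]
  constructor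
  · rintro ⟨g, rfl⟩
    exact ⟨g.1, g.2, rfl⟩
  · rintro ⟨g, hg, rfl⟩
    exact ⟨⟨g, hg⟩, rfl⟩

theorem self_mem_orbit (G : Subgroup (V ≃ₗᵢ[ℝ] V)) (x : V) : x ∈ (orbitMk G x).orbit :=
  mem_orbit_orbitMk.2 ⟨1, G.one_mem, rfl⟩

theorem mapsTo_closure_orbit {G : Subgroup (V ≃ₗᵢ[ℝ] V)} {g : V ≃ₗᵢ[ℝ] V} (hg : g ∈ G)
    {x p : V} (hp : p ∈ closure (orbitMk G x).orbit) : g p ∈ closure (orbitMk G x).orbit := by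
  refine map_mem_closure g.continuous hp fun q hq => ?_
  obtain ⟨h, hh, rfl⟩ := mem_orbit_orbitMk.1 hq
  exact mem_orbit_orbitMk.2 ⟨g * h, G.mul_mem hg hh, rfl⟩

theorem closure_orbit_subset {G : Subgroup (V ≃ₗᵢ[ℝ] V)} {x x' : V}
    (h : x' ∈ closure (orbitMk G x).orbit) :
    closure (orbitMk G x').orbit ⊆ closure (orbitMk G x).orbit := by
  refine closure_minimal (fun p hp => ?_) isClosed_closure
  obtain ⟨g, hg, rfl⟩ := mem_orbit_orbitMk.1 hp
  exact mapsTo_closure_orbit hg h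

/-- Working with orbit closures makes it unnecessary to know that the group is finite. The relation
is symmetric because the group acts by isometries: if `g x` is near `x'`, then `g⁻¹ x'` is equally
near `x`. -/
theorem closure_orbit_eq {G : Subgroup (V ≃ₗᵢ[ℝ] V)} {x x' : V}
    (h : x' ∈ closure (orbitMk G x).orbit) :
    closure (orbitMk G x').orbit = closure (orbitMk G x).orbit := by
  refine (closure_orbit_subset h).antisymm (closure_orbit_subset ?_)
  rw [Metric.mem_closure_iff] at h ⊢
  intro ε hε
  obtain ⟨p, hp, hpd⟩ := h ε hε
  obtain ⟨g, hg, rfl⟩ := mem_orbit_orbitMk.1 hp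
  refine ⟨g⁻¹ x', mem_orbit_orbitMk.2 ⟨g⁻¹, G.inv_mem hg, rfl⟩, ?_⟩
  rw [dist_comm, ← g.dist_map]
  have : g (g⁻¹ x') = x' := g.apply_symm_apply x'
  rwa [this]

theorem upperBounds_image_closure {X : Type*} [TopologicalSpace X] {f : X → ℝ}
    (hf : Continuous f) (S : Set X) : upperBounds (f '' closure S) = upperBounds (f '' S) := by
  refine (upperBounds_mono_set (Set.image_mono subset_closure)).antisymm fun b hb => ?_
  rintro _ ⟨x, hx, rfl⟩
  have : closure S ⊆ f ⁻¹' Set.Iic b :=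
    closure_minimal (fun z hz => hb ⟨z, hz, rfl⟩) (isClosed_Iic.preimage hf)
  exact this hx

/-- A continuous function has the same upper bounds on a set and on its closure, so the
representatives may be replaced by points of the orbit closures, where the supremum is attained. -/
theorem iSup_orbits_eq {G : Subgroup (V ≃ₗᵢ[ℝ] V)} {x y x' y' : V} {f : V × V → ℝ}
    (hf : Continuous f) (hx : x' ∈ closure (orbitMk G x).orbit)
    (hy : y' ∈ closure (orbitMk G y).orbit)
    (hmax : ∀ g ∈ G, ∀ h ∈ G, f (g x', h y') ≤ f (x', y')) :
    ⨆ p : (orbitMk G x).orbit × (orbitMk G y).orbit, f (p.1, p.2) = f (x', y') := by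
  have hub : upperBounds (f '' ((orbitMk G x).orbit ×ˢ (orbitMk G y).orbit)) =
      upperBounds (f '' ((orbitMk G x').orbit ×ˢ (orbitMk G y').orbit)) := by
    rw [← upperBounds_image_closure hf, ← upperBounds_image_closure hf (_ ×ˢ (orbitMk G y').orbit),
      closure_prod_eq, closure_prod_eq, closure_orbit_eq hx, closure_orbit_eq hy]
  have hlub : IsLUB (f '' ((orbitMk G x).orbit ×ˢ (orbitMk G y).orbit)) (f (x', y')) := by
    rw [IsLUB, hub]
    refine IsGreatest.isLUB ⟨⟨(x', y'), ⟨self_mem_orbit G x', self_mem_orbit G y'⟩, rfl⟩, ?_⟩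
    rintro _ ⟨⟨p, q⟩, ⟨hp, hq⟩, rfl⟩
    obtain ⟨g, hg, rfl⟩ := mem_orbit_orbitMk.1 hp
    obtain ⟨h, hh, rfl⟩ := mem_orbit_orbitMk.1 hq
    exact hmax g hg h hh
  have hrange : Set.range (fun p : (orbitMk G x).orbit × (orbitMk G y).orbit =>
      f (p.1, p.2)) = f '' ((orbitMk G x).orbit ×ˢ (orbitMk G y).orbit) := by
    ext r
    constructor
    · rintro ⟨⟨⟨p, hp⟩, ⟨q, hq⟩⟩, rfl⟩
      exact ⟨(p, q), ⟨hp, hq⟩, rfl⟩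
    · rintro ⟨⟨p, q⟩, ⟨hp, hq⟩, rfl⟩
      exact ⟨⟨⟨p, hp⟩, ⟨q, hq⟩⟩, rfl⟩
  have : Nonempty ((orbitMk G x).orbit × (orbitMk G y).orbit) :=
    ⟨⟨⟨x, self_mem_orbit G x⟩, ⟨y, self_mem_orbit G y⟩⟩⟩
  rw [← hrange] at hlub
  exact hlub.ciSup_eq

variable {ι : Type*}

/-- The group generated by the reflections in the hyperplanes orthogonal to the `α i`. -/
noncomputable def reflectionGroup (α : ι → V) : Subgroup (V ≃ₗᵢ[ℝ] V) :=
  Subgroup.closure (Set.range (simpleReflection α))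

/-- The closed chamber of the simple roots `α`. -/
def chamber (α : ι → V) : Set V := {x | ∀ i, 0 ≤ inner ℝ (α i) x}

/-- Maximize `⟪ρ, ·⟫` over the compact orbit closure. If the maximizer paired negatively with some
`αᵢ`, reflecting it in `αᵢ` would increase the value, since `⟪αᵢ, ρ⟫ = 1`. -/
theorem exists_mem_chamber [FiniteDimensional ℝ V] {α : ι → V}
    (hα : ∀ i, inner ℝ (α i) (α i) = 1) {ρ : V} (hρ : ∀ i, inner ℝ (α i) ρ = 1) (x : V) :
    ∃ x' ∈ chamber α, x' ∈ closure (orbitMk (reflectionGroup α) x).orbit := by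
  have hcomp : IsCompact (closure (orbitMk (reflectionGroup α) x).orbit) := by
    refine Metric.isCompact_of_isClosed_isBounded isClosed_closure (Bornology.IsBounded.closure ?_)
    refine (Metric.isBounded_closedBall (x := (0 : V)) (r := ‖x‖)).subset fun p hp => ?_
    obtain ⟨g, -, rfl⟩ := mem_orbit_orbitMk.1 hp
    simp
  obtain ⟨x', hx', hmax⟩ := hcomp.exists_isMaxOn ⟨x, subset_closure (self_mem_orbit _ x)⟩
    (f := fun p => inner ℝ ρ p) (by fun_prop)
  refine ⟨x', fun i => ?_, hx'⟩
  have hmem : simpleReflection α i ∈ reflectionGroup α := Subgroup.subset_closure ⟨i, rfl⟩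
  have h := hmax (mapsTo_closure_orbit hmem hx')
  simp only [Set.mem_ofPred_eq] at h
  rw [simpleReflection_apply (hα i), inner_sub_right, inner_smul_right, real_inner_comm (α i) ρ,
    hρ i] at h
  linarith

theorem IsCoxeterBasis.inner_orbit_le {m : ι → ι → ℕ} {α : ι → V} (hα : IsCoxeterBasis m α)
    {x y : V} (hx : x ∈ chamber α) (hy : y ∈ chamber α) {g h : V ≃ₗᵢ[ℝ] V}
    (hg : g ∈ reflectionGroup α) (hh : h ∈ reflectionGroup α) :
    inner ℝ (g x) (h y) ≤ inner ℝ x y := by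
  have h1 : inner ℝ (g x) (h y) = inner ℝ ((h⁻¹ * g) x) y := by
    rw [← h.inner_map_map ((h⁻¹ * g) x) y]
    have : h ((h⁻¹ * g) x) = g x := h.apply_symm_apply (g x)
    rw [this]
  rw [h1]
  exact hα.inner_apply_le hx hy (isWord_of_mem_closure (simpleReflection_mul_self α)
    (Subgroup.mul_mem _ (Subgroup.inv_mem _ hh) hg))

theorem IsCoxeterBasis.maxFilter_eq {m : ι → ι → ℕ} {α : ι → V} (hα : IsCoxeterBasis m α)
    {x y x' y' : V} (hx : x' ∈ chamber α) (hy : y' ∈ chamber α)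
    (hxx : x' ∈ closure (orbitMk (reflectionGroup α) x).orbit)
    (hyy : y' ∈ closure (orbitMk (reflectionGroup α) y).orbit) :
    maxFilter (orbitMk (reflectionGroup α) x) (orbitMk (reflectionGroup α) y) =
      inner ℝ x' y' :=
  iSup_orbits_eq (f := fun p => inner ℝ p.1 p.2) (by fun_prop) hxx hyy
    fun _ hg _ hh => hα.inner_orbit_le hx hy hg hh

theorem IsCoxeterBasis.orbitDist_eq {m : ι → ι → ℕ} {α : ι → V} (hα : IsCoxeterBasis m α)
    {x y x' y' : V} (hx : x' ∈ chamber α) (hy : y' ∈ chamber α)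
    (hxx : x' ∈ closure (orbitMk (reflectionGroup α) x).orbit)
    (hyy : y' ∈ closure (orbitMk (reflectionGroup α) y).orbit) :
    orbitDist (orbitMk (reflectionGroup α) x) (orbitMk (reflectionGroup α) y) =
      ‖x' - y'‖ := by
  -- The infimum of distances is minus a supremum. Since norms are constant on orbits, minimizing
  -- distance is the same as maximizing the inner product.
  have h := iSup_orbits_eq (f := fun p : V × V => -dist p.1 p.2) (by fun_prop) hxx hyy
    fun g hg h hh => ?_
  · rw [← dist_eq_norm, orbitDist, ← neg_inj, ← h]
    rw [iSup, iInf, ← Real.sSup_neg]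
    congr 1
    ext r
    simp [neg_eq_iff_eq_neg]
  · have h1 := hα.inner_orbit_le hx hy hg hh
    simp only [neg_le_neg_iff, dist_eq_norm]
    refine (sq_le_sq₀ (norm_nonneg _) (norm_nonneg _)).1 ?_
    rw [norm_sub_sq_real, norm_sub_sq_real, LinearIsometryEquiv.norm_map,
      LinearIsometryEquiv.norm_map]
    linarith

end Chamber

/-! ### The condition number from Perron data -/

section Kappa

variable {V ι : Type*} [NormedAddCommGroup V] [InnerProductSpace ℝ V]

theorem subset_closure_orbit (G : Subgroup (V ≃ₗᵢ[ℝ] V)) (x : V) :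
    x ∈ closure (orbitMk G x).orbit := subset_closure (self_mem_orbit G x)

theorem IsCoxeterBasis.dist_filterBank {m : ι → ι → ℕ} {α : ι → V} (hα : IsCoxeterBasis m α)
    {x y x' y' : V} (hx : x' ∈ chamber α) (hy : y' ∈ chamber α)
    (hxx : x' ∈ closure (orbitMk (reflectionGroup α) x).orbit)
    (hyy : y' ∈ closure (orbitMk (reflectionGroup α) y).orbit)
    {n : ℕ} {t t' : Fin n → V} (ht : ∀ k, t' k ∈ chamber α)
    (htt : ∀ k, t' k ∈ closure (orbitMk (reflectionGroup α) (t k)).orbit) :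
    dist (filterBank (reflectionGroup α) t (orbitMk _ x))
      (filterBank (reflectionGroup α) t (orbitMk _ y)) = √(∑ k, inner ℝ (t' k) (x' - y') ^ 2) := by
  rw [EuclideanSpace.dist_eq]
  congr 1
  refine Finset.sum_congr rfl fun k _ => ?_
  simp only [filterBank]
  rw [hα.maxFilter_eq (ht k) hx (htt k) hxx, hα.maxFilter_eq (ht k) hy (htt k) hyy,
    Real.dist_eq, sq_abs, inner_sub_right]

theorem IsCoxeterBasis.bounds_of_hasLipschitzBounds [Finite ι] [FiniteDimensional ℝ V]
    {m : ι → ι → ℕ} {α : ι → V} (hα : IsCoxeterBasis m α) {ρ : V}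
    (hρ : ∀ i, inner ℝ (α i) ρ = 1) {n : ℕ} {t t' : Fin n → V} (ht : ∀ k, t' k ∈ chamber α)
    (htt : ∀ k, t' k ∈ closure (orbitMk (reflectionGroup α) (t k)).orbit) {c C : ℝ}
    (h : HasLipschitzBounds (reflectionGroup α) t c C) (z : V) :
    c * ‖z‖ ≤ √(∑ k, inner ℝ (t' k) z ^ 2) ∧ √(∑ k, inner ℝ (t' k) z ^ 2) ≤ C * ‖z‖ := by
  cases nonempty_fintype ι
  -- Adding `R • ρ` raises each `⟪αᵢ, z⟫` by `R ≥ |⟪αᵢ, z⟫|`, so `z` is the difference of two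
  -- chamber points.
  set R : ℝ := ∑ i, |inner ℝ (α i) z| with hR
  have hR0 : 0 ≤ R := Finset.sum_nonneg fun _ _ => abs_nonneg _
  have hy : R • ρ ∈ chamber α := fun i => by simpa [inner_smul_right, hρ] using hR0
  have hx : z + R • ρ ∈ chamber α := fun i => by
    rw [inner_add_right, inner_smul_right, hρ, mul_one]
    have h1 : |inner ℝ (α i) z| ≤ R :=
      Finset.single_le_sum (f := fun i => |inner ℝ (α i) z|) (fun _ _ => abs_nonneg _)
        (Finset.mem_univ i)
    linarith [neg_abs_le (inner ℝ (α i) z)]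
  have h1 := h.2.2 (orbitMk _ (z + R • ρ)) (orbitMk _ (R • ρ))
  rw [hα.dist_filterBank hx hy (subset_closure_orbit _ _) (subset_closure_orbit _ _) ht htt,
    hα.orbitDist_eq hx hy (subset_closure_orbit _ _) (subset_closure_orbit _ _),
    add_sub_cancel_right] at h1
  exact h1

theorem norm_sq_sum_smul [Fintype ι] [DecidableEq ι] {α : ι → V} {N : Matrix ι ι ℝ}
    (hN : ∀ i j, inner ℝ (α i) (α j) = (1 : Matrix ι ι ℝ) i j - N i j) (a : ι → ℝ) :
    ‖∑ i, a i • α i‖ ^ 2 = ∑ i, a i ^ 2 - ∑ i, ∑ j, N i j * (a i * a j) := by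
  rw [← real_inner_self_eq_norm_sq, sum_inner, ← Finset.sum_sub_distrib]
  refine Finset.sum_congr rfl fun i _ => ?_
  simp only [inner_sum, inner_smul_left, inner_smul_right, hN, conj_trivial, mul_sub,
    Finset.sum_sub_distrib, Matrix.one_apply]
  congr 1
  · simp [sq]
  · exact Finset.sum_congr rfl fun j _ => by ring

/-- A positive eigenvector bounds the whole quadratic form, by the weighted inequality `2 aᵢ aⱼ ≤
(vⱼ / vᵢ) aᵢ² + (vᵢ / vⱼ) aⱼ²` summed against `N`. -/
theorem sum_mul_le_of_perron [Fintype ι] {N : Matrix ι ι ℝ} (hN : ∀ i j, 0 ≤ N i j)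
    (hsymm : ∀ i j, N i j = N j i) {v : ι → ℝ} (hv : ∀ i, 0 < v i) {k : ℝ}
    (hNv : ∀ i, ∑ j, N i j * v j = k * v i) (a : ι → ℝ) :
    ∑ i, ∑ j, N i j * (a i * a j) ≤ k * ∑ i, a i ^ 2 := by
  have hterm : ∀ i j, N i j * (a i * a j) ≤
      (N i j * v j * (a i ^ 2 / v i) + N i j * v i * (a j ^ 2 / v j)) / 2 := fun i j => by
    have h1 : 2 * (a i * a j) ≤ v j * (a i ^ 2 / v i) + v i * (a j ^ 2 / v j) := by
      have hi := hv i
      have hj := hv j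
      have : v j * (a i ^ 2 / v i) + v i * (a j ^ 2 / v j) - 2 * (a i * a j) =
          (v j * a i - v i * a j) ^ 2 / (v i * v j) := by
        field_simp
        ring
      have h2 : 0 ≤ (v j * a i - v i * a j) ^ 2 / (v i * v j) := by positivity
      linarith
    nlinarith [mul_le_mul_of_nonneg_left h1 (hN i j)]
  have hsum : ∑ i, ∑ j, N i j * v j * (a i ^ 2 / v i) = k * ∑ i, a i ^ 2 := by
    rw [Finset.mul_sum]
    refine Finset.sum_congr rfl fun i _ => ?_
    rw [← Finset.sum_mul, hNv]
    have := (hv i).ne'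
    field_simp
  have hsum' : ∑ i, ∑ j, N i j * v i * (a j ^ 2 / v j) = k * ∑ i, a i ^ 2 := by
    rw [Finset.sum_comm, ← hsum]
    exact Finset.sum_congr rfl fun i _ => Finset.sum_congr rfl fun j _ => by rw [hsymm]
  calc _ ≤ ∑ i, ∑ j, (N i j * v j * (a i ^ 2 / v i) + N i j * v i * (a j ^ 2 / v j)) / 2 :=
        Finset.sum_le_sum fun i _ => Finset.sum_le_sum fun j _ => hterm i j
    _ = k * ∑ i, a i ^ 2 := by
        simp only [← Finset.sum_div, Finset.sum_add_distrib]
        rw [hsum, hsum']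
        ring

theorem sum_mul_sign [Fintype ι] {N : Matrix ι ι ℝ} {ε : ι → ℝ}
    (hε : ∀ i j, N i j * (ε i * ε j) = -N i j) (a : ι → ℝ) :
    ∑ i, ∑ j, N i j * ((ε i * a i) * (ε j * a j)) = -∑ i, ∑ j, N i j * (a i * a j) := by
  simp only [← Finset.sum_neg_distrib]
  refine Finset.sum_congr rfl fun i _ => Finset.sum_congr rfl fun j _ => ?_
  linear_combination a i * a j * hε i j

/-- A nonnegative symmetric matrix with a positive eigenvector `v` for the eigenvalue `k < 1` whose
graph is bipartite with colouring `ε`. -/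
structure IsPerronData [Fintype ι] (N : Matrix ι ι ℝ) (v ε : ι → ℝ) (k : ℝ) : Prop where
  nonneg : ∀ i j, 0 ≤ N i j
  symm : ∀ i j, N i j = N j i
  pos : ∀ i, 0 < v i
  sign_sq : ∀ i, ε i ^ 2 = 1
  sign_mul : ∀ i j, N i j * (ε i * ε j) = -N i j
  eigen : ∀ i, ∑ j, N i j * v j = k * v i
  lt_one : k < 1

namespace IsPerronData

variable [Fintype ι] {N : Matrix ι ι ℝ} {v ε : ι → ℝ} {k : ℝ}

theorem sum_le (h : IsPerronData N v ε k) (a : ι → ℝ) :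
    ∑ i, ∑ j, N i j * (a i * a j) ≤ k * ∑ i, a i ^ 2 :=
  sum_mul_le_of_perron h.nonneg h.symm h.pos h.eigen a

theorem neg_le_sum (h : IsPerronData N v ε k) (a : ι → ℝ) :
    -(k * ∑ i, a i ^ 2) ≤ ∑ i, ∑ j, N i j * (a i * a j) := by
  have h1 := h.sum_le fun i => ε i * a i
  rw [sum_mul_sign h.sign_mul] at h1
  simp only [mul_pow, h.sign_sq, one_mul] at h1
  linarith

theorem sum_eq (h : IsPerronData N v ε k) :
    ∑ i, ∑ j, N i j * (v i * v j) = k * ∑ i, v i ^ 2 := by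
  rw [Finset.mul_sum]
  refine Finset.sum_congr rfl fun i _ => ?_
  rw [show k * v i ^ 2 = v i * (k * v i) by ring, ← h.eigen, Finset.mul_sum]
  exact Finset.sum_congr rfl fun j _ => by ring

theorem eigenvalue_nonneg [Nonempty ι] (h : IsPerronData N v ε k) : 0 ≤ k := by
  obtain ⟨i⟩ := ‹Nonempty ι›
  have h1 : 0 ≤ k * v i := by
    rw [← h.eigen]
    exact Finset.sum_nonneg fun j _ => mul_nonneg (h.nonneg i j) (h.pos j).le
  exact nonneg_of_mul_nonneg_left h1 (h.pos i)

variable [DecidableEq ι] {α : ι → V}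

theorem le_norm_sq (h : IsPerronData N v ε k)
    (hN : ∀ i j, inner ℝ (α i) (α j) = (1 : Matrix ι ι ℝ) i j - N i j) (a : ι → ℝ) :
    (1 - k) * ∑ i, a i ^ 2 ≤ ‖∑ i, a i • α i‖ ^ 2 := by
  rw [norm_sq_sum_smul hN]
  linarith [h.sum_le a]

theorem norm_sq_le (h : IsPerronData N v ε k)
    (hN : ∀ i j, inner ℝ (α i) (α j) = (1 : Matrix ι ι ℝ) i j - N i j) (a : ι → ℝ) :
    ‖∑ i, a i • α i‖ ^ 2 ≤ (1 + k) * ∑ i, a i ^ 2 := by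
  rw [norm_sq_sum_smul hN]
  linarith [h.neg_le_sum a]

theorem norm_sq_perron (h : IsPerronData N v ε k)
    (hN : ∀ i j, inner ℝ (α i) (α j) = (1 : Matrix ι ι ℝ) i j - N i j) :
    ‖∑ i, v i • α i‖ ^ 2 = (1 - k) * ∑ i, v i ^ 2 := by
  rw [norm_sq_sum_smul hN, h.sum_eq]
  ring

theorem norm_sq_sign_perron (h : IsPerronData N v ε k)
    (hN : ∀ i j, inner ℝ (α i) (α j) = (1 : Matrix ι ι ℝ) i j - N i j) :
    ‖∑ i, (ε i * v i) • α i‖ ^ 2 = (1 + k) * ∑ i, v i ^ 2 := by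
  rw [norm_sq_sum_smul hN, sum_mul_sign h.sign_mul, h.sum_eq]
  simp only [mul_pow, h.sign_sq, one_mul]
  ring

theorem linearIndependent (h : IsPerronData N v ε k)
    (hN : ∀ i j, inner ℝ (α i) (α j) = (1 : Matrix ι ι ℝ) i j - N i j) :
    LinearIndependent ℝ α := by
  rw [Fintype.linearIndependent_iff]
  intro a ha i
  have h1 := h.le_norm_sq hN a
  rw [ha, norm_zero, zero_pow two_ne_zero] at h1
  have h2 : ∑ i, a i ^ 2 ≤ 0 := by
    by_contra! hpos
    nlinarith [h.lt_one, mul_pos (sub_pos.2 h.lt_one) hpos]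
  have h3 := (Finset.single_le_sum (f := fun i => a i ^ 2) (fun _ _ => sq_nonneg _)
    (Finset.mem_univ i)).trans h2
  exact pow_eq_zero_iff two_ne_zero |>.1 (le_antisymm h3 (sq_nonneg _))

/-- The frame bounds are compared on two vectors that differ only in the signs of their root
coefficients. -/
theorem sqrt_le_div [FiniteDimensional ℝ V] [Nonempty ι] (h : IsPerronData N v ε k)
    (hN : ∀ i j, inner ℝ (α i) (α j) = (1 : Matrix ι ι ℝ) i j - N i j)
    {m : ι → ι → ℕ} (hα : IsCoxeterBasis m α) {ρ : V} (hρ : ∀ i, inner ℝ (α i) ρ = 1)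
    {n : ℕ} {t : Fin n → V} {c C : ℝ} (hb : HasLipschitzBounds (reflectionGroup α) t c C) :
    √((1 + k) / (1 - k)) ≤ C / c := by
  choose t' ht' htt' using fun j => exists_mem_chamber hα.inner_self hρ (t j)
  have hbd := hα.bounds_of_hasLipschitzBounds hρ ht' htt' hb
  obtain ⟨hc, hC, -⟩ := hb
  have hk := sub_pos.2 h.lt_one
  set S := ∑ i, v i ^ 2
  have hS : 0 < S := Finset.sum_pos (fun i _ => pow_pos (h.pos i) 2) Finset.univ_nonempty
  -- Each `⟪t' j, αᵢ⟫` is nonnegative, so introducing signs can only cause cancellation.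
  have hle : ∑ j, inner ℝ (t' j) (∑ i, (ε i * v i) • α i) ^ 2 ≤
      ∑ j, inner ℝ (t' j) (∑ i, v i • α i) ^ 2 := by
    refine Finset.sum_le_sum fun j _ => sq_le_sq.2 ?_
    refine le_trans ?_ (le_abs_self _)
    simp only [inner_sum, inner_smul_right]
    refine (Finset.abs_sum_le_sum_abs _ _).trans (Finset.sum_le_sum fun i _ => ?_)
    have hε : |ε i| = 1 := by
      rw [← sq_eq_sq₀ (abs_nonneg _) zero_le_one, sq_abs, h.sign_sq, one_pow]
    have hi : 0 ≤ inner ℝ (t' j) (α i) := by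
      rw [real_inner_comm]
      exact ht' j i
    rw [abs_mul, abs_mul, hε, one_mul, abs_of_pos (h.pos i), abs_of_nonneg hi]
  have hchain := ((hbd _).1.trans (Real.sqrt_le_sqrt hle)).trans (hbd _).2
  have hsq := pow_le_pow_left₀ (by positivity) hchain 2
  rw [mul_pow, mul_pow, h.norm_sq_sign_perron hN, h.norm_sq_perron hN] at hsq
  refine Real.sqrt_le_iff.2 ⟨by positivity, ?_⟩
  rw [div_pow, div_le_div_iff₀ hk (by positivity)]
  refine le_of_mul_le_mul_right ?_ hS
  linarith

/-- With the dual basis as templates, the filter values of a difference `z` are its root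
coefficients, so the two norms are compared by the Gram matrix `1 - N`. -/
theorem hasLipschitzBounds_dual [FiniteDimensional ℝ V] [Nonempty ι] (h : IsPerronData N v ε k)
    (hN : ∀ i j, inner ℝ (α i) (α j) = (1 : Matrix ι ι ℝ) i j - N i j)
    {m : ι → ι → ℕ} (hα : IsCoxeterBasis m α) {ρ : V} (hρ : ∀ i, inner ℝ (α i) ρ = 1)
    {n : ℕ} (e : Fin n ≃ ι) {w : ι → V} (hw : ∀ i, w i ∈ chamber α)
    (hexp : ∀ z, ∑ i, inner ℝ (w i) z • α i = z) :
    HasLipschitzBounds (reflectionGroup α) (fun j => w (e j)) (√(1 + k))⁻¹ (√(1 - k))⁻¹ := by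
  have hk := sub_pos.2 h.lt_one
  have hk0 := h.eigenvalue_nonneg
  refine ⟨by positivity, by positivity, fun x y => ?_⟩
  induction x using Quotient.inductionOn' with | _ x
  induction y using Quotient.inductionOn' with | _ y
  obtain ⟨x', hx, hxx⟩ := exists_mem_chamber hα.inner_self hρ x
  obtain ⟨y', hy, hyy⟩ := exists_mem_chamber hα.inner_self hρ y
  change _ * orbitDist (orbitMk _ x) (orbitMk _ y) ≤
    dist (filterBank _ _ (orbitMk _ x)) (filterBank _ _ (orbitMk _ y)) ∧
    dist (filterBank _ _ (orbitMk _ x)) (filterBank _ _ (orbitMk _ y)) ≤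
      _ * orbitDist (orbitMk _ x) (orbitMk _ y)
  rw [hα.dist_filterBank hx hy hxx hyy (fun j => hw (e j)) (fun j => subset_closure_orbit _ _),
    hα.orbitDist_eq hx hy hxx hyy, e.sum_comp fun i => inner ℝ (w i) (x' - y') ^ 2]
  have h1 := h.le_norm_sq hN fun i => inner ℝ (w i) (x' - y')
  have h2 := h.norm_sq_le hN fun i => inner ℝ (w i) (x' - y')
  rw [hexp] at h1 h2
  constructor
  · rw [inv_mul_le_iff₀ (by positivity), ← Real.sqrt_mul (by positivity)]
    exact Real.le_sqrt_of_sq_le h2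
  · rw [le_inv_mul_iff₀ (by positivity), ← Real.sqrt_mul hk.le]
    exact Real.sqrt_le_iff.2 ⟨norm_nonneg _, h1⟩

theorem kappa_reflectionGroup [FiniteDimensional ℝ V] [Nonempty ι] (h : IsPerronData N v ε k)
    (hN : ∀ i j, inner ℝ (α i) (α j) = (1 : Matrix ι ι ℝ) i j - N i j)
    {m : ι → ι → ℕ} (hα : IsCoxeterBasis m α)
    (hcard : Fintype.card ι = Module.finrank ℝ V) :
    kappa (reflectionGroup α) = √((1 + k) / (1 - k)) := by
  have hk := sub_pos.2 h.lt_one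
  have hk0 := h.eigenvalue_nonneg
  let b := basisOfLinearIndependentOfCardEqFinrank (h.linearIndependent hN) hcard
  have hb : ∀ i, b i = α i := fun i => by simp [b]
  let w : ι → V := fun i => (InnerProductSpace.toDual ℝ V).symm
    (LinearMap.toContinuousLinearMap (b.coord i))
  have hw : ∀ i z, inner ℝ (w i) z = b.repr z i := fun i z => by
    simp [w, InnerProductSpace.toDual_symm_apply]
  have hαw : ∀ i j, inner ℝ (α i) (w j) = if i = j then 1 else 0 := fun i j => by
    rw [real_inner_comm, hw, ← hb, b.repr_self, Finsupp.single_apply]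
  have hwc : ∀ i, w i ∈ chamber α := fun j i => by
    rw [hαw]
    split_ifs <;> norm_num
  -- The sum of the fundamental weights serves as `ρ`.
  have hρ : ∀ i, inner ℝ (α i) (∑ j, w j) = 1 := fun i => by simp [inner_sum, hαw]
  have hexp : ∀ z, ∑ i, inner ℝ (w i) z • α i = z := fun z => by
    simp only [hw, ← hb]
    exact b.sum_repr z
  refine IsLeast.csInf_eq ⟨⟨_, _, _, _, h.hasLipschitzBounds_dual hN hα hρ
    (Fintype.equivFin ι).symm hwc hexp, ?_⟩, ?_⟩
  · rw [Real.sqrt_div (by positivity)]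
    field_simp
  · rintro _ ⟨n, t, c, C, hb, rfl⟩
    exact h.sqrt_le_div hN hα hρ hb

end IsPerronData

/-- The matrix `(cos (π / mᵢⱼ))` with zero diagonal. -/
noncomputable def cosMatrix {d : ℕ} (M : CoxeterMatrix (Fin d)) : Matrix (Fin d) (Fin d) ℝ :=
  Matrix.of fun i j => if i = j then 0 else Real.cos (Real.pi / M i j)

theorem neg_cos_eq_one_sub_cosMatrix {d : ℕ} (M : CoxeterMatrix (Fin d)) (i j : Fin d) :
    -Real.cos (Real.pi / (M i j : ℝ)) = (1 : Matrix _ _ ℝ) i j - cosMatrix M i j := by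
  by_cases h : i = j <;> simp [cosMatrix, Matrix.one_apply, h]

open scoped MatrixOrder in
theorem exists_vectors_of_posSemidef {d : ℕ} {A : Matrix (Fin d) (Fin d) ℝ} (hA : A.PosSemidef) :
    ∃ α : Fin d → EuclideanSpace ℝ (Fin d), ∀ i j, inner ℝ (α i) (α j) = A i j := by
  obtain ⟨B, rfl⟩ := CStarAlgebra.nonneg_iff_eq_star_mul_self.mp hA.nonneg
  refine ⟨fun i => WithLp.toLp 2 fun r => B r i, fun i j => ?_⟩
  simp [PiLp.inner_apply, Matrix.mul_apply, mul_comm]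

theorem kappaEq_of_isPerronData {d : ℕ} [NeZero d] {M : CoxeterMatrix (Fin d)}
    (hM : ∀ i j, M i j ≠ 0) {v ε : Fin d → ℝ} {k : ℝ} (h : IsPerronData (cosMatrix M) v ε k) :
    KappaEq M √((1 + k) / (1 - k)) := by
  constructor
  -- Existence of the roots: the prescribed Gram matrix is positive semidefinite because `k < 1`.
  · have hA : (1 - cosMatrix M).PosSemidef := by
      refine Matrix.PosSemidef.of_dotProduct_mulVec_nonneg ?_ fun x => ?_
      · ext i j
        simp only [Matrix.conjTranspose_apply, Matrix.sub_apply, star_trivial, h.symm i j,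
          Matrix.one_apply, eq_comm]
      · have h1 := h.sum_le x
        have h2 : star x ⬝ᵥ ((1 - cosMatrix M).mulVec x) =
            ∑ i, x i ^ 2 - ∑ i, ∑ j, cosMatrix M i j * (x i * x j) := by
          rw [Matrix.sub_mulVec, Matrix.one_mulVec, dotProduct_sub]
          congr 1
          · simp [dotProduct, sq]
          · simp only [dotProduct, Matrix.mulVec, Finset.mul_sum, star_trivial]
            exact Finset.sum_congr rfl fun i _ => Finset.sum_congr rfl fun j _ => by ring
        rw [h2]
        have h3 : 0 ≤ ∑ i, x i ^ 2 := Finset.sum_nonneg fun _ _ => sq_nonneg _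
        nlinarith [h.lt_one]
    obtain ⟨α, hα⟩ := exists_vectors_of_posSemidef hA
    exact ⟨_, α, fun i j => by rw [hα, neg_cos_eq_one_sub_cosMatrix]; rfl, rfl⟩
  · rintro G ⟨α, hα, rfl⟩
    refine h.kappa_reflectionGroup (m := fun i j => M i j) (α := α)
      (fun i j => by rw [hα, neg_cos_eq_one_sub_cosMatrix])
      ⟨fun i => by rw [hα]; simp, fun i j _ => hα i j, fun i j hij => ?_⟩ (by simp)
    have h1 := M.off_diagonal i j hij
    have h2 := hM i j
    omega

theorem KappaEq.congr {d : ℕ} {M : CoxeterMatrix (Fin d)} {r r' : ℝ} (h : KappaEq M r)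
    (hr : r = r') : KappaEq M r' := hr ▸ h

/-- A positive eigenvector and a two-colouring of the Coxeter diagram determine `κ`. -/
theorem kappaEq_of_eigenvector {d : ℕ} [NeZero d] {M : CoxeterMatrix (Fin d)}
    (hM : ∀ i j, M i j ≠ 0) {v : Fin d → ℝ} {k : ℝ} (hv : ∀ i, 0 < v i) (hk : k < 1)
    (b : Fin d → Bool) (hb : ∀ i j, i ≠ j → M i j ≠ 2 → b i ≠ b j)
    (heig : ∀ i, ∑ j, cosMatrix M i j * v j = k * v i) : KappaEq M √((1 + k) / (1 - k)) := by
  refine kappaEq_of_isPerronData hM (v := v) (ε := fun i => if b i then 1 else -1)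
    ⟨fun i j => ?_, fun i j => ?_, hv, fun i => ?_, fun i j => ?_, heig, hk⟩
  · by_cases hij : i = j
    · simp [cosMatrix, hij]
    · have h2 : 2 ≤ M i j := by
        have h1 := M.off_diagonal i j hij
        have h2 := hM i j
        omega
      have h3 : (2 : ℝ) ≤ M i j := by exact_mod_cast h2
      simp only [cosMatrix, Matrix.of_apply, if_neg hij]
      refine Real.cos_nonneg_of_neg_pi_div_two_le_of_le
        (by have : 0 ≤ Real.pi / M i j := by positivity
            linarith [Real.pi_pos]) ?_
      exact div_le_div_of_nonneg_left Real.pi_pos.le two_pos h3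
  · simp [cosMatrix, M.symmetric i j, eq_comm]
  · split_ifs <;> norm_num
  · by_cases hij : i = j
    · simp [cosMatrix, hij]
    · by_cases h2 : M i j = 2
      · simp [cosMatrix, hij, h2]
      · have := hb i j hij h2
        cases hi : b i <;> cases hj : b j <;> simp_all

end Kappa

/-! ### Minimal polynomials via cyclotomic polynomials -/

section MinimalPolynomials

open scoped IntermediateField in
theorem natDegree_minpoly_le_of_mem {κ : ℝ} (hκ : IsIntegral ℚ κ) {ζ : ℂ}
    (hζ : ζ ∈ ℚ⟮(κ : ℂ)⟯ ⊔ ℚ⟮Complex.I⟯) :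
    (minpoly ℚ ζ).natDegree ≤ 2 * (minpoly ℚ κ).natDegree := by
  have hI : IsIntegral ℚ Complex.I := ⟨X ^ 2 + 1, by monicity!, by simp⟩
  have hκC : IsIntegral ℚ (κ : ℂ) := hκ.algebraMap (B := ℂ)
  have := IntermediateField.adjoin.finiteDimensional hκC
  have := IntermediateField.adjoin.finiteDimensional hI
  have h1 : Module.finrank ℚ ℚ⟮Complex.I⟯ ≤ 2 := by
    rw [IntermediateField.adjoin.finrank hI]
    refine (natDegree_le_of_dvd (minpoly.dvd ℚ Complex.I (p := X ^ 2 + 1) (by simp)) ?_).trans ?_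
    · exact (show (X ^ 2 + 1 : ℚ[X]).Monic by monicity!).ne_zero
    · compute_degree
  have h2 : Module.finrank ℚ ℚ⟮(κ : ℂ)⟯ = (minpoly ℚ κ).natDegree := by
    rw [IntermediateField.adjoin.finrank hκC]
    congr 1
    exact minpoly.algebraMap_eq (B := ℝ) (B' := ℂ) (algebraMap ℝ ℂ).injective κ
  have hle : ℚ⟮ζ⟯ ≤ ℚ⟮(κ : ℂ)⟯ ⊔ ℚ⟮Complex.I⟯ := by
    rwa [IntermediateField.adjoin_simple_le_iff]
  have hζi : IsIntegral ℚ ζ := by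
    have := (IsIntegral.of_finite ℚ (⟨ζ, hζ⟩ : ↥(ℚ⟮(κ : ℂ)⟯ ⊔ ℚ⟮Complex.I⟯))).map
      (ℚ⟮(κ : ℂ)⟯ ⊔ ℚ⟮Complex.I⟯).val
    exact this
  rw [← IntermediateField.adjoin.finrank hζi]
  have : Module.Finite ℚ ↥(Subalgebra.toSubmodule
      (ℚ⟮(κ : ℂ)⟯ ⊔ ℚ⟮Complex.I⟯).toSubalgebra) :=
    inferInstanceAs (FiniteDimensional ℚ ↥(ℚ⟮(κ : ℂ)⟯ ⊔ ℚ⟮Complex.I⟯))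
  have h3 := Submodule.finrank_mono (R := ℚ) (M := ℂ)
    (s := Subalgebra.toSubmodule ℚ⟮ζ⟯.toSubalgebra)
    (t := Subalgebra.toSubmodule (ℚ⟮(κ : ℂ)⟯ ⊔ ℚ⟮Complex.I⟯).toSubalgebra) hle
  have h4 := IntermediateField.finrank_sup_le ℚ⟮(κ : ℂ)⟯ ℚ⟮Complex.I⟯
  calc _ ≤ _ := h3
    _ ≤ _ := h4
    _ ≤ _ := by rw [h2, mul_comm]; exact Nat.mul_le_mul_right _ h1

open scoped IntermediateField in
/-- If `(κ + i) / (κ - i)` is a root of unity of order `N`, then `κ` has degree at least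
`φ(N) / 2`. -/
theorem minpoly_eq_of_cyclotomic {κ : ℝ} {P : ℚ[X]} (hP : P.Monic) (hroot : aeval κ P = 0)
    {N : ℕ} (hN : 0 < N) (hφ : N.totient = 2 * P.natDegree)
    (hζ : aeval (((κ : ℂ) + Complex.I) / (κ - Complex.I)) (cyclotomic N ℚ) = 0) :
    minpoly ℚ κ = P := by
  have hκ : IsIntegral ℚ κ := ⟨P, hP, hroot⟩
  have hmem : ((κ : ℂ) + Complex.I) / (κ - Complex.I) ∈ ℚ⟮(κ : ℂ)⟯ ⊔ ℚ⟮Complex.I⟯ := by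
    have h1 : (κ : ℂ) ∈ ℚ⟮(κ : ℂ)⟯ ⊔ ℚ⟮Complex.I⟯ :=
      le_sup_left (a := ℚ⟮(κ : ℂ)⟯) (IntermediateField.mem_adjoin_simple_self ℚ _)
    have h2 : Complex.I ∈ ℚ⟮(κ : ℂ)⟯ ⊔ ℚ⟮Complex.I⟯ :=
      le_sup_right (a := ℚ⟮(κ : ℂ)⟯) (IntermediateField.mem_adjoin_simple_self ℚ _)
    exact div_mem (add_mem h1 h2) (sub_mem h1 h2)
  have hdeg := natDegree_minpoly_le_of_mem hκ hmem
  rw [← minpoly.eq_of_irreducible_of_monic (cyclotomic.irreducible_rat hN) hζ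
    (cyclotomic.monic N ℚ), natDegree_cyclotomic, hφ] at hdeg
  -- The minimal polynomial divides `P`, and its degree is at least `φ(N) / 2`, the degree of `P`.
  exact (eq_of_monic_of_dvd_of_natDegree_le (minpoly.monic hκ) hP (minpoly.dvd ℚ κ hroot)
    (by omega)).symm

/-- The quantity `2 cos (π / h)` for `κ = cot (π / (2 h))`. -/
noncomputable def twoCos (κ : ℝ) : ℝ := 2 * (κ ^ 2 - 1) / (κ ^ 2 + 1)

theorem twoCos_lt_two (κ : ℝ) : twoCos κ < 2 := by
  rw [twoCos, div_lt_iff₀ (by positivity)]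
  linarith

theorem lt_twoCos {κ a : ℝ} (h : a * (κ ^ 2 + 1) < 2 * (κ ^ 2 - 1)) : a < twoCos κ := by
  rwa [twoCos, lt_div_iff₀ (by positivity)]

theorem sqrt_twoCos {κ : ℝ} (hκ : 0 < κ) :
    √((1 + twoCos κ / 2) / (1 - twoCos κ / 2)) = κ := by
  have : (1 + twoCos κ / 2) / (1 - twoCos κ / 2) = κ ^ 2 := by
    rw [div_eq_iff (by linarith [twoCos_lt_two κ]), twoCos]
    field_simp
    ring
  rw [this, Real.sqrt_sq hκ.le]

theorem ofReal_sub_I_ne_zero (κ : ℝ) : (κ : ℂ) - Complex.I ≠ 0 := fun h => by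
  simpa using congrArg Complex.im h

theorem ofReal_add_I_ne_zero (κ : ℝ) : (κ : ℂ) + Complex.I ≠ 0 := fun h => by
  simpa using congrArg Complex.im h

theorem twoCos_eq_add_inv (κ : ℝ) {ζ : ℂ} (hζ : ζ = ((κ : ℂ) + Complex.I) / (κ - Complex.I)) :
    ζ ≠ 0 ∧ (twoCos κ : ℂ) = ζ + ζ⁻¹ := by
  have h1 := ofReal_sub_I_ne_zero κ
  have h2 := ofReal_add_I_ne_zero κ
  have h3 : (κ : ℂ) ^ 2 + 1 = (κ + Complex.I) * (κ - Complex.I) := by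
    linear_combination Complex.I_sq
  refine ⟨hζ ▸ div_ne_zero h2 h1, ?_⟩
  rw [hζ, inv_div, twoCos]
  push_cast
  rw [h3]
  field_simp
  linear_combination (-2 : ℂ) * Complex.I_sq

theorem cyclotomic_twelve : cyclotomic 12 ℚ = X ^ 4 - X ^ 2 + 1 := by
  rw [show 12 = 6 * 2 from rfl, ← cyclotomic_expand_eq_cyclotomic Nat.prime_two (by norm_num) ℚ,
    cyclotomic_six]
  simp [← pow_mul]

theorem cyclotomic_twentyFour : cyclotomic 24 ℚ = X ^ 8 - X ^ 4 + 1 := by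
  rw [show 24 = 12 * 2 from rfl, ← cyclotomic_expand_eq_cyclotomic Nat.prime_two (by norm_num) ℚ,
    cyclotomic_twelve]
  simp [← pow_mul]

theorem cyclotomic_thirtySix : cyclotomic 36 ℚ = X ^ 12 - X ^ 6 + 1 := by
  rw [show 36 = 12 * 3 from rfl, ← cyclotomic_expand_eq_cyclotomic Nat.prime_three (by norm_num) ℚ,
    cyclotomic_twelve]
  simp [← pow_mul]

theorem cyclotomic_ten : cyclotomic 10 ℚ = X ^ 4 - X ^ 3 + X ^ 2 - X + 1 := by
  have h := cyclotomic_expand_eq_cyclotomic_mul (n := 2) Nat.prime_five (by norm_num) ℚ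
  refine mul_right_cancel₀ (cyclotomic_ne_zero 2 ℚ) (h.symm.trans ?_)
  rw [cyclotomic_two]
  simp
  ring

theorem cyclotomic_twenty : cyclotomic 20 ℚ = X ^ 8 - X ^ 6 + X ^ 4 - X ^ 2 + 1 := by
  rw [show 20 = 10 * 2 from rfl, ← cyclotomic_expand_eq_cyclotomic Nat.prime_two (by norm_num) ℚ,
    cyclotomic_ten]
  simp [← pow_mul]

theorem cyclotomic_thirty :
    cyclotomic 30 ℚ = X ^ 8 + X ^ 7 - X ^ 5 - X ^ 4 - X ^ 3 + X + 1 := by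
  have h := cyclotomic_expand_eq_cyclotomic_mul (n := 6) Nat.prime_five (by norm_num) ℚ
  refine mul_right_cancel₀ (cyclotomic_ne_zero 6 ℚ) (h.symm.trans ?_)
  rw [cyclotomic_six]
  simp
  ring

theorem cyclotomic_sixty :
    cyclotomic 60 ℚ = X ^ 16 + X ^ 14 - X ^ 10 - X ^ 8 - X ^ 6 + X ^ 2 + 1 := by
  rw [show 60 = 30 * 2 from rfl, ← cyclotomic_expand_eq_cyclotomic Nat.prime_two (by norm_num) ℚ,
    cyclotomic_thirty]
  simp [← pow_mul]

theorem exists_root_of_sign_change {f : ℝ → ℝ} (hf : Continuous f) {a b : ℝ} (hab : a ≤ b)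
    (ha : f a ≤ 0) (hb : 0 ≤ f b) : ∃ κ, a ≤ κ ∧ κ ≤ b ∧ f κ = 0 := by
  obtain ⟨κ, ⟨h1, h2⟩, h3⟩ := intermediate_value_Icc hab hf.continuousOn ⟨ha, hb⟩
  exact ⟨κ, h1, h2, h3⟩

theorem exists_kappa_twelve : ∃ κ : ℝ, 7.5957 ≤ κ ∧ κ ≤ 7.59577 ∧
    minpoly ℚ κ = X ^ 4 - 8 * X ^ 3 + 2 * X ^ 2 + 8 * X + 1 ∧
    twoCos κ ^ 4 - 4 * twoCos κ ^ 2 + 1 = 0 := by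
  obtain ⟨κ, h1, h2, h3⟩ := exists_root_of_sign_change
    (f := fun κ => κ ^ 4 - 8 * κ ^ 3 + 2 * κ ^ 2 + 8 * κ + 1) (by fun_prop)
    (a := 7.5957) (b := 7.59577) (by norm_num) (by norm_num) (by norm_num)
  have hx : twoCos κ ^ 4 - 4 * twoCos κ ^ 2 + 1 = 0 := by
    rw [twoCos]
    field_simp
    -- With `P` the polynomial vanishing at `κ`, the cleared numerator is `P(κ) P(-κ)`; it is even
    -- in `κ` because `twoCos` is. The cofactor here is `P(-κ)`, as in the analogous theorems below.
    linear_combination (κ ^ 4 + 8 * κ ^ 3 + 2 * κ ^ 2 - 8 * κ + 1) * h3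
  refine ⟨κ, h1, h2, ?_, hx⟩
  have hdeg : (X ^ 4 - 8 * X ^ 3 + 2 * X ^ 2 + 8 * X + 1 : ℚ[X]).natDegree = 4 := by
    compute_degree!
  refine minpoly_eq_of_cyclotomic (N := 24) (by monicity!) (by simpa [map_ofNat] using h3) (by norm_num)
    (by rw [hdeg]; decide) ?_
  obtain ⟨ζ, hζ⟩ : ∃ ζ, ζ = ((κ : ℂ) + Complex.I) / (κ - Complex.I) := ⟨_, rfl⟩
  obtain ⟨h0, hζx⟩ := twoCos_eq_add_inv κ hζ
  -- Substituting `ζ + ζ⁻¹` into the equation for `twoCos κ` and clearing denominators gives exactly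
  -- the cyclotomic equation for `ζ`.
  rw [← hζ, cyclotomic_twentyFour]
  have hxC := congrArg (Complex.ofReal) hx
  push_cast at hxC
  rw [hζx] at hxC
  field_simp at hxC
  simp only [map_add, map_sub, map_pow, aeval_X, map_one]
  linear_combination hxC

theorem exists_kappa_eighteen : ∃ κ : ℝ, 11.43003 ≤ κ ∧ κ ≤ 11.43008 ∧
    minpoly ℚ κ = X ^ 6 - 12 * X ^ 5 + 3 * X ^ 4 + 40 * X ^ 3 + 3 * X ^ 2 - 12 * X + 1 ∧
    twoCos κ ^ 6 - 6 * twoCos κ ^ 4 + 9 * twoCos κ ^ 2 - 3 = 0 := by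
  obtain ⟨κ, h1, h2, h3⟩ := exists_root_of_sign_change
    (f := fun κ => κ ^ 6 - 12 * κ ^ 5 + 3 * κ ^ 4 + 40 * κ ^ 3 + 3 * κ ^ 2 - 12 * κ + 1)
    (by fun_prop) (a := 11.43003) (b := 11.43008) (by norm_num) (by norm_num) (by norm_num)
  have hx : twoCos κ ^ 6 - 6 * twoCos κ ^ 4 + 9 * twoCos κ ^ 2 - 3 = 0 := by
    rw [twoCos]
    field_simp
    linear_combination
      (κ ^ 6 + 12 * κ ^ 5 + 3 * κ ^ 4 - 40 * κ ^ 3 + 3 * κ ^ 2 + 12 * κ + 1) * h3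
  refine ⟨κ, h1, h2, ?_, hx⟩
  have hdeg : (X ^ 6 - 12 * X ^ 5 + 3 * X ^ 4 + 40 * X ^ 3 + 3 * X ^ 2 - 12 * X + 1 :
      ℚ[X]).natDegree = 6 := by
    compute_degree!
  refine minpoly_eq_of_cyclotomic (N := 36) (by monicity!) (by simpa [map_ofNat] using h3) (by norm_num)
    (by rw [hdeg]; decide) ?_
  obtain ⟨ζ, hζ⟩ : ∃ ζ, ζ = ((κ : ℂ) + Complex.I) / (κ - Complex.I) := ⟨_, rfl⟩
  obtain ⟨h0, hζx⟩ := twoCos_eq_add_inv κ hζ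
  rw [← hζ, cyclotomic_thirtySix]
  have hxC := congrArg (Complex.ofReal) hx
  push_cast at hxC
  rw [hζx] at hxC
  field_simp at hxC
  simp only [map_add, map_sub, map_pow, aeval_X, map_one]
  linear_combination hxC

theorem exists_kappa_ten : ∃ κ : ℝ, 6.3137 ≤ κ ∧ κ ≤ 6.31378 ∧
    minpoly ℚ κ = X ^ 4 - 4 * X ^ 3 - 14 * X ^ 2 - 4 * X + 1 ∧
    twoCos κ ^ 4 - 5 * twoCos κ ^ 2 + 5 = 0 := by
  obtain ⟨κ, h1, h2, h3⟩ := exists_root_of_sign_change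
    (f := fun κ => κ ^ 4 - 4 * κ ^ 3 - 14 * κ ^ 2 - 4 * κ + 1) (by fun_prop)
    (a := 6.3137) (b := 6.31378) (by norm_num) (by norm_num) (by norm_num)
  have hx : twoCos κ ^ 4 - 5 * twoCos κ ^ 2 + 5 = 0 := by
    rw [twoCos]
    field_simp
    linear_combination (κ ^ 4 + 4 * κ ^ 3 - 14 * κ ^ 2 + 4 * κ + 1) * h3
  refine ⟨κ, h1, h2, ?_, hx⟩
  have hdeg : (X ^ 4 - 4 * X ^ 3 - 14 * X ^ 2 - 4 * X + 1 : ℚ[X]).natDegree = 4 := by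
    compute_degree!
  refine minpoly_eq_of_cyclotomic (N := 20) (by monicity!) (by simpa [map_ofNat] using h3) (by norm_num)
    (by rw [hdeg]; decide) ?_
  obtain ⟨ζ, hζ⟩ : ∃ ζ, ζ = ((κ : ℂ) + Complex.I) / (κ - Complex.I) := ⟨_, rfl⟩
  obtain ⟨h0, hζx⟩ := twoCos_eq_add_inv κ hζ
  rw [← hζ, cyclotomic_twenty]
  have hxC := congrArg (Complex.ofReal) hx
  push_cast at hxC
  rw [hζx] at hxC
  field_simp at hxC
  simp only [map_add, map_sub, map_pow, aeval_X, map_one]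
  linear_combination hxC

theorem exists_kappa_thirty : ∃ κ : ℝ, 19.0811 ≤ κ ∧ κ ≤ 19.08115 ∧
    minpoly ℚ κ = X ^ 8 - 16 * X ^ 7 - 60 * X ^ 6 + 16 * X ^ 5 + 134 * X ^ 4 + 16 * X ^ 3
      - 60 * X ^ 2 - 16 * X + 1 ∧
    twoCos κ ^ 8 - 7 * twoCos κ ^ 6 + 14 * twoCos κ ^ 4 - 8 * twoCos κ ^ 2 + 1 = 0 := by
  obtain ⟨κ, h1, h2, h3⟩ := exists_root_of_sign_change
    (f := fun κ => κ ^ 8 - 16 * κ ^ 7 - 60 * κ ^ 6 + 16 * κ ^ 5 + 134 * κ ^ 4 + 16 * κ ^ 3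
      - 60 * κ ^ 2 - 16 * κ + 1) (by fun_prop)
    (a := 19.0811) (b := 19.08115) (by norm_num) (by norm_num) (by norm_num)
  have hx : twoCos κ ^ 8 - 7 * twoCos κ ^ 6 + 14 * twoCos κ ^ 4 - 8 * twoCos κ ^ 2 + 1 = 0 := by
    rw [twoCos]
    field_simp
    linear_combination (κ ^ 8 + 16 * κ ^ 7 - 60 * κ ^ 6 - 16 * κ ^ 5 + 134 * κ ^ 4
      - 16 * κ ^ 3 - 60 * κ ^ 2 + 16 * κ + 1) * h3
  refine ⟨κ, h1, h2, ?_, hx⟩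
  have hdeg : (X ^ 8 - 16 * X ^ 7 - 60 * X ^ 6 + 16 * X ^ 5 + 134 * X ^ 4 + 16 * X ^ 3
      - 60 * X ^ 2 - 16 * X + 1 : ℚ[X]).natDegree = 8 := by
    compute_degree!
  refine minpoly_eq_of_cyclotomic (N := 60) (by monicity!) (by simpa [map_ofNat] using h3) (by norm_num)
    (by rw [hdeg]; decide) ?_
  obtain ⟨ζ, hζ⟩ : ∃ ζ, ζ = ((κ : ℂ) + Complex.I) / (κ - Complex.I) := ⟨_, rfl⟩
  obtain ⟨h0, hζx⟩ := twoCos_eq_add_inv κ hζ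
  rw [← hζ, cyclotomic_sixty]
  have hxC := congrArg (Complex.ofReal) hx
  push_cast at hxC
  rw [hζx] at hxC
  field_simp at hxC
  simp only [map_add, map_sub, map_pow, aeval_X, map_one]
  linear_combination hxC

end MinimalPolynomials

/-! ### Eigenvectors for the exceptional types -/

section Exceptional

theorem kappaEq_of_twoCos {d : ℕ} [NeZero d] {M : CoxeterMatrix (Fin d)}
    (hM : ∀ i j, M i j ≠ 0) {v : Fin d → ℝ} {κ : ℝ} (hκ : 0 < κ) (hv : ∀ i, 0 < v i)
    (b : Fin d → Bool) (hb : ∀ i j, i ≠ j → M i j ≠ 2 → b i ≠ b j)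
    (heig : ∀ i, ∑ j, cosMatrix M i j * v j = twoCos κ / 2 * v i) : KappaEq M κ :=
  (kappaEq_of_eigenvector hM hv (by linarith [twoCos_lt_two κ]) b hb heig).congr (sqrt_twoCos hκ)

/-- These Chebyshev values are the eigenvector entries along an arm, counted from its leaf. The
threshold lies just below `2 cos (π / 10) ≈ 1.902`, the smallest value needed (type `H₃`). -/
theorem chebyshev_pos {x : ℝ} (hx : 1.9 < x) :
    0 < x ^ 2 - 1 ∧ 0 < x ^ 3 - 2 * x ∧ 0 < x ^ 4 - 3 * x ^ 2 + 1 := by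
  have h : 3.61 < x ^ 2 := by nlinarith
  refine ⟨by linarith, ?_, by nlinarith⟩
  have : x ^ 3 - 2 * x = x * (x ^ 2 - 2) := by ring
  rw [this]
  exact mul_pos (by linarith) (by linarith)

theorem kappaEq_E₆ {κ : ℝ} (hκ : 7.5957 ≤ κ)
    (hx : twoCos κ ^ 4 - 4 * twoCos κ ^ 2 + 1 = 0) : KappaEq CoxeterMatrix.E₆ κ := by
  have hlt : 1.9 < twoCos κ := lt_twoCos (by nlinarith)
  obtain ⟨p2, p3, p4⟩ := chebyshev_pos hlt
  generalize hX : twoCos κ = x at *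
  have p1 : 0 < x := by linarith
  refine kappaEq_of_twoCos (fun i j => ?_) (by linarith)
    -- Each arm carries `1, x, x² - 1, …` from its leaf, rescaled so that the arms agree at the
    -- branch node. Only the equation at that node then uses `hx`. Types `E₇` and `E₈` follow the
    -- same pattern.
    (v := ![x, x ^ 2 - 1, x ^ 2, x * (x ^ 2 - 1), x ^ 2, x])
    (fun i => ?_) ![true, false, false, true, false, true] (fun i j => ?_) (fun i => ?_)
  · fin_cases i <;> fin_cases j <;> simp [CoxeterMatrix.E₆]
  · fin_cases i <;> simp [p1, p2]
  · fin_cases i <;> fin_cases j <;> simp [CoxeterMatrix.E₆]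
  · rw [hX]
    fin_cases i <;> simp [Fin.sum_univ_succ, cosMatrix, CoxeterMatrix.E₆] <;>
      first | ring1 | linear_combination (-1 / 2) * hx

theorem kappaEq_E₇ {κ : ℝ} (hκ : 11.43003 ≤ κ)
    (hx : twoCos κ ^ 6 - 6 * twoCos κ ^ 4 + 9 * twoCos κ ^ 2 - 3 = 0) :
    KappaEq CoxeterMatrix.E₇ κ := by
  have hlt : 1.9 < twoCos κ := lt_twoCos (by nlinarith)
  obtain ⟨p2, p3, p4⟩ := chebyshev_pos hlt
  generalize hX : twoCos κ = x at *
  have p1 : 0 < x := by linarith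
  refine kappaEq_of_twoCos (fun i j => ?_) (by linarith)
    (v := ![(x ^ 3 - 2 * x) * x, (x ^ 3 - 2 * x) * (x ^ 2 - 1), (x ^ 3 - 2 * x) * x * x,
      (x ^ 3 - 2 * x) * (x * (x ^ 2 - 1)), (x ^ 2 - 1) * (x * (x ^ 2 - 1)),
      x * (x * (x ^ 2 - 1)), x * (x ^ 2 - 1)])
    (fun i => ?_) ![true, false, false, true, false, true, false] (fun i j => ?_) (fun i => ?_)
  · fin_cases i <;> fin_cases j <;> simp [CoxeterMatrix.E₇]
  · fin_cases i <;> simp [p1, p2, p3]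
  · fin_cases i <;> fin_cases j <;> simp [CoxeterMatrix.E₇]
  · rw [hX]
    fin_cases i <;> simp [Fin.sum_univ_succ, cosMatrix, CoxeterMatrix.E₇] <;>
      first | ring1 | linear_combination (-x / 2) * hx

theorem kappaEq_E₈ {κ : ℝ} (hκ : 19.0811 ≤ κ)
    (hx : twoCos κ ^ 8 - 7 * twoCos κ ^ 6 + 14 * twoCos κ ^ 4 - 8 * twoCos κ ^ 2 + 1 = 0) :
    KappaEq CoxeterMatrix.E₈ κ := by
  have hlt : 1.9 < twoCos κ := lt_twoCos (by nlinarith)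
  obtain ⟨p2, p3, p4⟩ := chebyshev_pos hlt
  generalize hX : twoCos κ = x at *
  have p1 : 0 < x := by linarith
  refine kappaEq_of_twoCos (fun i j => ?_) (by linarith)
    (v := ![(x ^ 4 - 3 * x ^ 2 + 1) * x, (x ^ 4 - 3 * x ^ 2 + 1) * (x ^ 2 - 1),
      (x ^ 4 - 3 * x ^ 2 + 1) * x * x, (x ^ 4 - 3 * x ^ 2 + 1) * (x * (x ^ 2 - 1)),
      (x ^ 3 - 2 * x) * (x * (x ^ 2 - 1)), (x ^ 2 - 1) * (x * (x ^ 2 - 1)),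
      x * (x * (x ^ 2 - 1)), x * (x ^ 2 - 1)])
    (fun i => ?_) ![true, false, false, true, false, true, false, true] (fun i j => ?_) (fun i => ?_)
  · fin_cases i <;> fin_cases j <;> simp [CoxeterMatrix.E₈]
  · fin_cases i <;> simp [p1, p2, p3, p4]
  · fin_cases i <;> fin_cases j <;> simp [CoxeterMatrix.E₈]
  · rw [hX]
    fin_cases i <;> simp [Fin.sum_univ_succ, cosMatrix, CoxeterMatrix.E₈] <;>
      first | ring1 | linear_combination (-1 / 2) * hx

theorem kappaEq_F₄ {κ : ℝ} (hκ : 7.5957 ≤ κ)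
    (hx : twoCos κ ^ 4 - 4 * twoCos κ ^ 2 + 1 = 0) : KappaEq CoxeterMatrix.F₄ κ := by
  have hlt : 1.9 < twoCos κ := lt_twoCos (by nlinarith)
  obtain ⟨p2, p3, p4⟩ := chebyshev_pos hlt
  generalize hX : twoCos κ = x at *
  have p1 : 0 < x := by linarith
  -- This is the eigenvector equation at either end of the edge labelled 4. Positivity selects this
  -- sign of the square root.
  have hs : √2 * x = x ^ 2 - 1 := by
    have h2 := Real.sq_sqrt (show (0 : ℝ) ≤ 2 by norm_num)
    rw [← sq_eq_sq₀ (by positivity) p2.le]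
    linear_combination x ^ 2 * h2 - hx
  refine kappaEq_of_twoCos (fun i j => ?_) (by linarith) (v := ![1, x, x, 1])
    (fun i => ?_) ![true, false, true, false] (fun i j => ?_) (fun i => ?_)
  · fin_cases i <;> fin_cases j <;> simp [CoxeterMatrix.F₄]
  · fin_cases i <;> simp [p1]
  · fin_cases i <;> fin_cases j <;> simp [CoxeterMatrix.F₄]
  · rw [hX]
    fin_cases i <;> simp [Fin.sum_univ_succ, cosMatrix, CoxeterMatrix.F₄] <;>
      first | ring1 | linear_combination (1 / 2) * hs

theorem kappaEq_H₃ {κ : ℝ} (hκ : 6.3137 ≤ κ)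
    (hx : twoCos κ ^ 4 - 5 * twoCos κ ^ 2 + 5 = 0) : KappaEq CoxeterMatrix.H₃ κ := by
  have hlt : 1.9 < twoCos κ := lt_twoCos (by nlinarith)
  obtain ⟨p2, p3, p4⟩ := chebyshev_pos hlt
  generalize hX : twoCos κ = x at *
  have p1 : 0 < x := by linarith
  have h5 := Real.sq_sqrt (show (0 : ℝ) ≤ 5 by norm_num)
  -- Since `2 cos (π / 5)` is the golden ratio `φ`, the equation at the middle node is `1 + φ² =
  -- x²`.
  have hs : √5 = 2 * x ^ 2 - 5 := by
    rw [← sq_eq_sq₀ (by positivity) (by nlinarith)]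
    linear_combination h5 - 4 * hx
  refine kappaEq_of_twoCos (fun i j => ?_) (by linarith) (v := ![1, x, (1 + √5) / 2])
    (fun i => ?_) ![true, false, true] (fun i j => ?_) (fun i => ?_)
  · fin_cases i <;> fin_cases j <;> simp [CoxeterMatrix.H₃]
  · fin_cases i <;> simp [p1] ; positivity
  · fin_cases i <;> fin_cases j <;> simp [CoxeterMatrix.H₃]
  · rw [hX]
    fin_cases i <;> simp [Fin.sum_univ_succ, cosMatrix, CoxeterMatrix.H₃] <;>
      first | ring1 | linear_combination (1 / 8) * h5 + (1 / 4) * hs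

theorem kappaEq_H₄ {κ : ℝ} (hκ : 19.0811 ≤ κ)
    (hx : twoCos κ ^ 8 - 7 * twoCos κ ^ 6 + 14 * twoCos κ ^ 4 - 8 * twoCos κ ^ 2 + 1 = 0) :
    KappaEq CoxeterMatrix.H₄ κ := by
  have hlt : 1.9 < twoCos κ := lt_twoCos (by nlinarith)
  obtain ⟨p2, p3, p4⟩ := chebyshev_pos hlt
  generalize hX : twoCos κ = x at *
  have p1 : 0 < x := by linarith
  have h5 := Real.sq_sqrt (show (0 : ℝ) ≤ 5 by norm_num)
  -- With `φ` the golden ratio, this is the third-node equation `x² + φ² (x² - 1) = x² (x² - 1)`.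
  have hs : √5 * (x ^ 2 - 1) = 2 * (x ^ 4 - 2 * x ^ 2) - 3 * (x ^ 2 - 1) := by
    rw [← sq_eq_sq₀ (by positivity) (by nlinarith)]
    linear_combination (x ^ 2 - 1) ^ 2 * h5 - 4 * hx
  refine kappaEq_of_twoCos (fun i j => ?_) (by linarith)
    (v := ![x, x * x, x * (x ^ 2 - 1), (1 + √5) / 2 * (x ^ 2 - 1)])
    (fun i => ?_) ![true, false, true, false] (fun i j => ?_) (fun i => ?_)
  · fin_cases i <;> fin_cases j <;> simp [CoxeterMatrix.H₄]
  · fin_cases i <;> simp [p1, p2] ; positivity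
  · fin_cases i <;> fin_cases j <;> simp [CoxeterMatrix.H₄]
  · rw [hX]
    fin_cases i <;> simp [Fin.sum_univ_succ, cosMatrix, CoxeterMatrix.H₄] <;>
      first | ring1 | linear_combination (1 / 8) * (x ^ 2 - 1) * h5 + (1 / 4) * hs

end Exceptional

/-! ### The infinite families and their asymptotics -/

section Families

/-- Node `j` sits at position `j + 1`, so the chain neighbours of node `i` have positions `i` and `i
+ 2`. The condition on `a` discards neighbours beyond the ends. -/
theorem sum_fin_ite_succ {l : ℕ} (a : ℕ) (g : ℕ → ℝ) :
    ∑ j : Fin l, (if (j : ℕ) + 1 = a then g (j + 1) else 0) =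
      if 1 ≤ a ∧ a ≤ l then g a else 0 := by
  rw [Fin.sum_univ_eq_sum_range (fun j => if j + 1 = a then g (j + 1) else 0) l]
  split_ifs with h
  · rw [Finset.sum_eq_single (a - 1)]
    · rw [if_pos (by omega), Nat.sub_add_cancel h.1]
    · intro b _ hb
      rw [if_neg (by omega)]
    · intro ha
      simp only [Finset.mem_range] at ha
      omega
  · refine Finset.sum_eq_zero fun j hj => ?_
    rw [Finset.mem_range] at hj
    rw [if_neg (by omega)]

theorem sin_add_sin (θ : ℝ) (n : ℕ) :
    Real.sin (n * θ) / 2 + Real.sin (((n + 2 : ℕ) : ℝ) * θ) / 2 =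
      Real.cos θ * Real.sin (((n + 1 : ℕ) : ℝ) * θ) := by
  have h1 : (n : ℝ) * θ = (n + 1 : ℕ) * θ - θ := by push_cast; ring
  have h2 : ((n + 2 : ℕ) : ℝ) * θ = (n + 1 : ℕ) * θ + θ := by push_cast; ring
  rw [h1, h2, Real.sin_sub, Real.sin_add]
  ring

theorem sin_natCast_mul_pos {θ : ℝ} {n : ℕ} (hθ : 0 < θ) (hn : 0 < n) (h : n * θ < Real.pi) :
    0 < Real.sin (n * θ) :=
  Real.sin_pos_of_pos_of_lt_pi (by positivity) h

theorem cos_lt_one {θ : ℝ} (h0 : 0 < θ) (h : θ ≤ Real.pi) : Real.cos θ < 1 := by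
  rw [← Real.cos_zero]
  exact Real.cos_lt_cos_of_nonneg_of_le_pi le_rfl h h0

/-- `√((1 + cos θ) / (1 - cos θ))`, that is, `cot (θ / 2)`. -/
noncomputable def condNumber (θ : ℝ) : ℝ := √((1 + Real.cos θ) / (1 - Real.cos θ))

theorem kappaEq_A {l : ℕ} (hl : 1 ≤ l) :
    KappaEq (CoxeterMatrix.A l) (condNumber (Real.pi / (l + 1))) := by
  have : NeZero l := ⟨by omega⟩
  set θ := Real.pi / (l + 1) with hθ
  have hθ0 : 0 < θ := by positivity
  have hθl : (l + 1) * θ = Real.pi := by rw [hθ]; field_simp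
  have hlR : (1 : ℝ) ≤ l := by exact_mod_cast hl
  refine kappaEq_of_eigenvector (fun i j => ?_)
    (v := fun i => Real.sin (((i + 1 : ℕ) : ℝ) * θ)) (fun i => ?_)
    (cos_lt_one hθ0 (by nlinarith)) (fun i => decide ((i : ℕ) % 2 = 0)) (fun i j hij h => ?_)
    (fun i => ?_)
  · simp only [CoxeterMatrix.A, Matrix.of_apply]
    split_ifs <;> norm_num
  · refine sin_natCast_mul_pos hθ0 (by omega) ?_
    have : ((i + 1 : ℕ) : ℝ) ≤ l := by exact_mod_cast i.2
    nlinarith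
  · simp only [CoxeterMatrix.A, Matrix.of_apply, if_neg hij, ne_eq, ite_eq_right_iff] at h
    simp only [ne_eq, decide_eq_decide]
    omega
  · have hterm : ∀ j : Fin l, cosMatrix (CoxeterMatrix.A l) i j *
        Real.sin (((j + 1 : ℕ) : ℝ) * θ) =
        (if (j : ℕ) + 1 = i then Real.sin (((j + 1 : ℕ) : ℝ) * θ) / 2 else 0) +
        (if (j : ℕ) + 1 = i + 2 then Real.sin (((j + 1 : ℕ) : ℝ) * θ) / 2 else 0) := fun j => by
      simp only [cosMatrix, CoxeterMatrix.A, Matrix.of_apply, Fin.ext_iff]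
      split_ifs <;> first | (exfalso; omega) | simp <;> ring
    simp only [hterm, Finset.sum_add_distrib]
    rw [sum_fin_ite_succ i fun n => Real.sin (n * θ) / 2,
      sum_fin_ite_succ (i + 2) fun n => Real.sin (n * θ) / 2, ← sin_add_sin]
    -- The missing neighbours cost nothing, as the sine vanishes at positions `0` and `l + 1`.
    congr 1
    · split_ifs with h
      · rfl
      · have : (i : ℕ) = 0 := by omega
        simp [this]
    · split_ifs with h
      · rfl
      · have : ((i + 2 : ℕ) : ℝ) = l + 1 := by
          have : (i : ℕ) + 2 = l + 1 := by omega
          exact_mod_cast this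
        rw [this, hθl]
        simp

theorem kappaEq_B {l : ℕ} (hl : 2 ≤ l) :
    KappaEq (CoxeterMatrix.B l) (condNumber (Real.pi / (2 * l))) := by
  have : NeZero l := ⟨by omega⟩
  have hlR : (2 : ℝ) ≤ l := by exact_mod_cast hl
  set θ := Real.pi / (2 * l) with hθ
  have hθ0 : 0 < θ := by positivity
  have hθl : l * θ = Real.pi / 2 := by rw [hθ]; field_simp
  have hsq := Real.mul_self_sqrt (show (0 : ℝ) ≤ 2 by norm_num)
  refine kappaEq_of_eigenvector (fun i j => ?_)
    -- A quarter wave, with `sin (lθ) = 1` at the last node. That entry is scaled by `√2 / 2`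
    -- because its edge, labelled 4, has weight `√2 / 2` instead of `1 / 2`.
    (v := fun i => if (i : ℕ) + 1 = l then √2 / 2 else Real.sin (((i + 1 : ℕ) : ℝ) * θ))
    (fun i => ?_)
    (cos_lt_one hθ0 (by nlinarith)) (fun i => decide ((i : ℕ) % 2 = 0)) (fun i j hij h => ?_)
    (fun i => ?_)
  · simp only [CoxeterMatrix.B, Matrix.of_apply]
    split_ifs <;> norm_num
  · split_ifs
    · positivity
    · refine sin_natCast_mul_pos hθ0 (by omega) ?_
      have : ((i + 1 : ℕ) : ℝ) ≤ l := by exact_mod_cast i.2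
      nlinarith [Real.pi_pos]
  · simp only [CoxeterMatrix.B, Matrix.of_apply, if_neg hij] at h
    simp only [ne_eq, decide_eq_decide]
    split_ifs at h <;> omega
  · have hsl : Real.sin (l * θ) = 1 := by rw [hθl, Real.sin_pi_div_two]
    have hterm : ∀ j : Fin l, cosMatrix (CoxeterMatrix.B l) i j *
        (if (j : ℕ) + 1 = l then √2 / 2 else Real.sin (((j + 1 : ℕ) : ℝ) * θ)) =
        (if (j : ℕ) + 1 = i then (if (i : ℕ) + 1 = l then √2 / 2 else 1 / 2) *
          Real.sin (((j + 1 : ℕ) : ℝ) * θ) else 0) +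
        (if (j : ℕ) + 1 = i + 2 then Real.sin (((j + 1 : ℕ) : ℝ) * θ) / 2 else 0) := fun j => by
      by_cases hj : (j : ℕ) + 1 = l
      · rw [hj, hsl]
        simp only [cosMatrix, CoxeterMatrix.B, Matrix.of_apply, Fin.ext_iff]
        split_ifs <;> first | (exfalso; omega) | simp <;> linarith
      · simp only [cosMatrix, CoxeterMatrix.B, Matrix.of_apply, Fin.ext_iff]
        split_ifs <;> first | (exfalso; omega) | simp <;> ring
    simp only [hterm, Finset.sum_add_distrib]
    rw [sum_fin_ite_succ i fun n => (if (i : ℕ) + 1 = l then √2 / 2 else 1 / 2) *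
      Real.sin (n * θ), sum_fin_ite_succ (i + 2) fun n => Real.sin (n * θ) / 2]
    have hi := i.2
    by_cases h : (i : ℕ) + 1 = l
    · have hcos : Real.sin (i * θ) = Real.cos θ := by
        have hiR : (l : ℝ) = i + 1 := by exact_mod_cast h.symm
        have : (i : ℝ) * θ = Real.pi / 2 - θ := by linear_combination hθl - θ * hiR
        rw [this, Real.sin_pi_div_two_sub]
      rw [if_pos (by omega), if_pos h, if_neg (by omega), if_pos h, hcos]
      ring
    · rw [if_neg h, if_neg h, if_pos (by omega : 1 ≤ (i : ℕ) + 2 ∧ (i : ℕ) + 2 ≤ l),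
        ← sin_add_sin]
      congr 1
      split_ifs with h'
      · ring
      · have : (i : ℕ) = 0 := by omega
        simp [this]

theorem kappaEq_D {l : ℕ} (hl : 4 ≤ l) :
    KappaEq (coxeterD l) (condNumber (Real.pi / (2 * (l - 1)))) := by
  have : NeZero l := ⟨by omega⟩
  have hlR : (4 : ℝ) ≤ l := by exact_mod_cast hl
  set θ := Real.pi / (2 * (l - 1)) with hθ
  have hl1 : (0 : ℝ) < l - 1 := by linarith
  have hθ0 : 0 < θ := by positivity
  have hθl : (l - 1) * θ = Real.pi / 2 := by rw [hθ]; field_simp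
  refine kappaEq_of_eigenvector (fun i j => ?_)
    -- The peak `sin ((l - 1)θ) = 1` of the quarter wave is split equally between the two fork ends.
    (v := fun i => if l < (i : ℕ) + 3 then 1 / 2 else Real.sin (((i + 1 : ℕ) : ℝ) * θ))
    (fun i => ?_)
    (cos_lt_one hθ0 (by nlinarith))
    -- The last node is attached to node `l - 3`, of equal parity, so its colour is shifted.
    (fun i => decide ((if (i : ℕ) + 1 = l then (i : ℕ) + 1 else i) % 2 = 0)) (fun i j hij h => ?_)
    (fun i => ?_)
  · simp only [coxeterD, Matrix.of_apply]
    split_ifs <;> norm_num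
  · split_ifs with h
    · norm_num
    · refine sin_natCast_mul_pos hθ0 (by omega) ?_
      have : ((i + 1 : ℕ) : ℝ) ≤ l - 1 := by
        have : (i : ℕ) + 1 + 1 ≤ l := by omega
        rw [le_sub_iff_add_le]
        exact_mod_cast this
      nlinarith [Real.pi_pos]
  · simp only [coxeterD, Matrix.of_apply, if_neg hij, ne_eq, ite_eq_right_iff] at h
    simp only [ne_eq, decide_eq_decide]
    split_ifs <;> omega
  · have hi := i.2
    have hterm : ∀ j : Fin l, cosMatrix (coxeterD l) i j *
        (if l < (j : ℕ) + 3 then 1 / 2 else Real.sin (((j + 1 : ℕ) : ℝ) * θ)) =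
        (if (j : ℕ) + 1 = (if (i : ℕ) + 1 = l then (i : ℕ) - 1 else i) then
          Real.sin (((j + 1 : ℕ) : ℝ) * θ) / 2 else 0) +
        (if (j : ℕ) + 1 = i + 2 then (if (j : ℕ) + 1 < l then
          (if l < (j : ℕ) + 1 + 2 then 1 / 4 else Real.sin (((j + 1 : ℕ) : ℝ) * θ) / 2) else 0)
          else 0) +
        (if (j : ℕ) + 1 = i + 3 then (if (j : ℕ) + 1 = l then 1 / 4 else 0) else 0) := fun j => by
      simp only [cosMatrix, coxeterD, Matrix.of_apply, Fin.ext_iff]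
      split_ifs <;> first | (exfalso; omega) | norm_num <;> ring
    simp only [hterm, Finset.sum_add_distrib]
    rw [sum_fin_ite_succ _ fun n => Real.sin (n * θ) / 2,
      sum_fin_ite_succ (i + 2) fun n => if n < l then
        (if l < n + 2 then 1 / 4 else Real.sin (n * θ) / 2) else 0,
      sum_fin_ite_succ (i + 3) fun n => if n = l then 1 / 4 else 0]
    have hcos : ∀ n : ℕ, n + 2 = l → Real.sin (n * θ) = Real.cos θ := fun n hn => by
      have : (n : ℝ) * θ = Real.pi / 2 - θ := by
        rw [← hθl, ← hn]
        push_cast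
        ring
      rw [this, Real.sin_pi_div_two_sub]
    rcases (by omega : (i : ℕ) + 1 = l ∨ (i : ℕ) + 2 = l ∨ (i : ℕ) + 3 = l ∨ (i : ℕ) + 3 < l)
      with h | h | h | h
    · rw [if_pos h, if_pos (by omega), if_neg (by omega), if_neg (by omega), if_pos (by omega),
        hcos _ (by omega)]
      ring
    · rw [if_neg (by omega : ¬(i : ℕ) + 1 = l), if_pos (by omega), if_pos (by omega),
        if_neg (by omega), if_neg (by omega), if_pos (by omega), hcos _ h]
      ring
    · have hone : Real.sin (((i + 2 : ℕ) : ℝ) * θ) = 1 := by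
        have : ((i + 2 : ℕ) : ℝ) = l - 1 := by
          have hiR : (l : ℝ) = i + 3 := by exact_mod_cast h.symm
          rw [hiR]
          push_cast
          ring
        rw [this, hθl, Real.sin_pi_div_two]
      rw [if_neg (by omega : ¬(i : ℕ) + 1 = l), if_pos (by omega), if_pos (by omega),
        if_pos (by omega), if_pos (by omega), if_pos (by omega), if_pos h, if_neg (by omega),
        ← sin_add_sin, hone]
      ring
    · rw [if_neg (by omega : ¬(i : ℕ) + 1 = l),
        if_pos (by omega : 1 ≤ (i : ℕ) + 2 ∧ (i : ℕ) + 2 ≤ l),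
        if_pos (by omega : (i : ℕ) + 2 < l), if_neg (by omega : ¬l < (i : ℕ) + 2 + 2),
        if_pos (by omega : 1 ≤ (i : ℕ) + 3 ∧ (i : ℕ) + 3 ≤ l),
        if_neg (by omega : ¬(i : ℕ) + 3 = l), if_neg (by omega : ¬l < (i : ℕ) + 3), ← sin_add_sin, add_zero]
      congr 1
      split_ifs with h'
      · rfl
      · have : (i : ℕ) = 0 := by omega
        simp [this]

theorem kappaEq_I {m : ℕ} (hm : 3 ≤ m) : KappaEq (coxeterI m) (condNumber (Real.pi / m)) := by
  have hmR : (3 : ℝ) ≤ m := by exact_mod_cast hm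
  have h2 : ∀ i j, coxeterI m i j = if i = j then 1 else m := fun i j => by
    simp only [coxeterI, CoxeterMatrix.I, Matrix.of_apply]
    rw [Nat.sub_add_cancel (by omega)]
  refine kappaEq_of_eigenvector (fun i j => ?_) (v := fun _ => 1) (fun _ => one_pos)
    (cos_lt_one (by positivity) (div_le_self Real.pi_pos.le (by linarith)))
    ![true, false] (fun i j hij _ => ?_) (fun i => ?_)
  · rw [h2]
    split_ifs <;> omega
  · fin_cases i <;> fin_cases j <;> simp_all
  · fin_cases i <;> simp [cosMatrix, h2]

/-- The half-angle formulas give `cot (θ / 2)`. Writing the product with `sinc` removes the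
singularity at `0`, so the limit follows by continuity. -/
theorem mul_condNumber {θ : ℝ} (h0 : 0 < θ) (h : θ < Real.pi) :
    θ * condNumber θ = 2 * Real.cos (θ / 2) / Real.sinc (θ / 2) := by
  have hs : 0 < Real.sin (θ / 2) := Real.sin_pos_of_pos_of_lt_pi (by linarith) (by linarith)
  have hc : 0 < Real.cos (θ / 2) :=
    Real.cos_pos_of_mem_Ioo ⟨by linarith, by linarith⟩
  have h1 : Real.cos θ = 2 * Real.cos (θ / 2) ^ 2 - 1 := by
    rw [← Real.cos_two_mul]
    congr 1
    ring
  have h2 := Real.sin_sq_add_cos_sq (θ / 2)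
  have h3 : (1 + Real.cos θ) / (1 - Real.cos θ) = (Real.cos (θ / 2) / Real.sin (θ / 2)) ^ 2 := by
    rw [div_pow, div_eq_div_iff (by nlinarith) (by positivity), h1]
    linear_combination 2 * Real.cos (θ / 2) ^ 2 * h2
  rw [condNumber, h3, Real.sqrt_sq (by positivity), Real.sinc_of_ne_zero (by linarith)]
  field_simp

theorem tendsto_mul_condNumber : Tendsto (fun θ => θ * condNumber θ) (𝓝[>] 0) (𝓝 2) := by
  have h : Tendsto (fun θ : ℝ => 2 * Real.cos (θ / 2) / Real.sinc (θ / 2)) (𝓝[>] 0) (𝓝 2) := by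
    have hc : ContinuousAt (fun θ : ℝ => 2 * Real.cos (θ / 2) / Real.sinc (θ / 2)) 0 := by
      refine ContinuousAt.div (by fun_prop) ?_ (by simp)
      exact (Real.continuous_sinc.comp (by fun_prop : Continuous fun θ : ℝ => θ / 2)).continuousAt
    have := hc.tendsto
    simp only [zero_div, Real.cos_zero, Real.sinc_zero, mul_one, div_one] at this
    exact this.mono_left nhdsWithin_le_nhds
  refine h.congr' ?_
  filter_upwards [Ioo_mem_nhdsGT Real.pi_pos] with θ hθ
  exact (mul_condNumber hθ.1 hθ.2).symm

theorem tendsto_condNumber_div {θ : ℕ → ℝ} (hpos : ∀ᶠ l in atTop, 0 < θ l) {a : ℝ} (ha : a ≠ 0)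
    (hθ : Tendsto (fun l => θ l * l) atTop (𝓝 a)) :
    Tendsto (fun l => condNumber (θ l) / l) atTop (𝓝 (2 / a)) := by
  have h0 : Tendsto θ atTop (𝓝 0) := by
    refine (hθ.div_atTop tendsto_natCast_atTop_atTop).congr' ?_
    filter_upwards [eventually_gt_atTop 0] with l hl
    have : (l : ℝ) ≠ 0 := by positivity
    field_simp
  have h1 : Tendsto θ atTop (𝓝[>] 0) := tendsto_nhdsWithin_iff.2 ⟨h0, hpos⟩
  refine ((tendsto_mul_condNumber.comp h1).div hθ ha).congr' ?_
  filter_upwards [hpos, eventually_gt_atTop 0] with l hl hl0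
  have : (l : ℝ) ≠ 0 := by positivity
  simp only [Pi.div_apply, Function.comp_apply]
  field_simp

theorem exists_error_of_tendsto {f : ℕ → ℝ} {L : ℝ}
    (h : Tendsto (fun l => f l / l) atTop (𝓝 L)) :
    ∃ ε : ℕ → ℝ, Tendsto ε atTop (𝓝 0) ∧ ∀ l : ℕ, 1 ≤ l → f l = (L + ε l) * l := by
  refine ⟨fun l => f l / l - L, by simpa using h.sub_const L, fun l hl => ?_⟩
  have : (l : ℝ) ≠ 0 := by positivity
  field_simp
  ring

theorem tendsto_condNumber_A :
    Tendsto (fun l : ℕ => condNumber (Real.pi / (l + 1)) / l) atTop (𝓝 (2 / Real.pi)) := by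
  refine tendsto_condNumber_div (Eventually.of_forall fun l => by positivity) Real.pi_ne_zero ?_
  have := (tendsto_natCast_div_add_atTop (1 : ℝ)).const_mul Real.pi
  rw [mul_one] at this
  exact this.congr fun l => by ring

theorem tendsto_condNumber_B :
    Tendsto (fun l : ℕ => condNumber (Real.pi / (2 * l)) / l) atTop (𝓝 (4 / Real.pi)) := by
  have := tendsto_condNumber_div (θ := fun l => Real.pi / (2 * l)) (a := Real.pi / 2) ?_
    (by positivity) ?_
  · convert this using 2
    field_simp
    norm_num
  · filter_upwards [eventually_gt_atTop 0] with l hl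
    positivity
  · refine tendsto_const_nhds.congr' ?_
    filter_upwards [eventually_gt_atTop 0] with l hl
    have : (l : ℝ) ≠ 0 := by positivity
    field_simp

theorem tendsto_condNumber_D :
    Tendsto (fun l : ℕ => condNumber (Real.pi / (2 * (l - 1))) / l) atTop
      (𝓝 (4 / Real.pi)) := by
  have := tendsto_condNumber_div (θ := fun l => Real.pi / (2 * (l - 1))) (a := Real.pi / 2) ?_
    (by positivity) ?_
  · convert this using 2
    field_simp
    norm_num
  · filter_upwards [eventually_gt_atTop 1] with l hl
    have : (1 : ℝ) < l := by exact_mod_cast hl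
    have : (0 : ℝ) < l - 1 := by linarith
    positivity
  · have := (tendsto_natCast_div_add_atTop (-1 : ℝ)).const_mul (Real.pi / 2)
    rw [mul_one] at this
    refine this.congr fun l => ?_
    rw [← sub_eq_add_neg, div_mul_div_comm, div_mul_eq_mul_div]

theorem tendsto_condNumber_I :
    Tendsto (fun m : ℕ => condNumber (Real.pi / m) / m) atTop (𝓝 (2 / Real.pi)) := by
  refine tendsto_condNumber_div ?_ Real.pi_ne_zero ?_
  · filter_upwards [eventually_gt_atTop 0] with l hl
    positivity
  · refine tendsto_const_nhds.congr' ?_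
    filter_upwards [eventually_gt_atTop 0] with l hl
    have : (l : ℝ) ≠ 0 := by positivity
    field_simp

end Families

end MaxFilter

theorem mainTheorem2 :
    -- the exceptional groups
    (∃ κ : ℝ, MaxFilter.KappaEq CoxeterMatrix.E₆ κ ∧ |κ - 7.5957| < 1 / 10 ^ 4 ∧
      minpoly ℚ κ = X ^ 4 - 8 * X ^ 3 + 2 * X ^ 2 + 8 * X + 1) ∧
    (∃ κ : ℝ, MaxFilter.KappaEq CoxeterMatrix.E₇ κ ∧ |κ - 11.4301| < 1 / 10 ^ 4 ∧
      minpoly ℚ κ = X ^ 6 - 12 * X ^ 5 + 3 * X ^ 4 + 40 * X ^ 3 + 3 * X ^ 2 - 12 * X + 1) ∧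
    (∃ κ : ℝ, MaxFilter.KappaEq CoxeterMatrix.E₈ κ ∧ |κ - 19.0811| < 1 / 10 ^ 4 ∧
      minpoly ℚ κ = X ^ 8 - 16 * X ^ 7 - 60 * X ^ 6 + 16 * X ^ 5 + 134 * X ^ 4 + 16 * X ^ 3
        - 60 * X ^ 2 - 16 * X + 1) ∧
    (∃ κ : ℝ, MaxFilter.KappaEq CoxeterMatrix.F₄ κ ∧ |κ - 7.5957| < 1 / 10 ^ 4 ∧
      minpoly ℚ κ = X ^ 4 - 8 * X ^ 3 + 2 * X ^ 2 + 8 * X + 1) ∧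
    (∃ κ : ℝ, MaxFilter.KappaEq CoxeterMatrix.H₃ κ ∧ |κ - 6.3137| < 1 / 10 ^ 4 ∧
      minpoly ℚ κ = X ^ 4 - 4 * X ^ 3 - 14 * X ^ 2 - 4 * X + 1) ∧
    (∃ κ : ℝ, MaxFilter.KappaEq CoxeterMatrix.H₄ κ ∧ |κ - 19.0811| < 1 / 10 ^ 4 ∧
      minpoly ℚ κ = X ^ 8 - 16 * X ^ 7 - 60 * X ^ 6 + 16 * X ^ 5 + 134 * X ^ 4 + 16 * X ^ 3
        - 60 * X ^ 2 - 16 * X + 1) ∧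
    -- the infinite families
    (∃ ε : ℕ → ℝ, Tendsto ε atTop (𝓝 0) ∧
      ∀ l : ℕ, 1 ≤ l →
        MaxFilter.KappaEq (CoxeterMatrix.A l) ((2 / Real.pi + ε l) * l)) ∧
    (∃ ε : ℕ → ℝ, Tendsto ε atTop (𝓝 0) ∧
      ∀ l : ℕ, 2 ≤ l →
        MaxFilter.KappaEq (CoxeterMatrix.B l) ((4 / Real.pi + ε l) * l)) ∧
    (∃ ε : ℕ → ℝ, Tendsto ε atTop (𝓝 0) ∧
      ∀ l : ℕ, 4 ≤ l →
        MaxFilter.KappaEq (MaxFilter.coxeterD l) ((4 / Real.pi + ε l) * l)) ∧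
    (∃ ε : ℕ → ℝ, Tendsto ε atTop (𝓝 0) ∧
      ∀ m : ℕ, 3 ≤ m →
        MaxFilter.KappaEq (MaxFilter.coxeterI m)
          (√((1 + Real.cos (Real.pi / m)) / (1 - Real.cos (Real.pi / m)))) ∧
        √((1 + Real.cos (Real.pi / m)) / (1 - Real.cos (Real.pi / m))) =
          (2 / Real.pi + ε m) * m) := by
  refine ⟨?_, ?_, ?_, ?_, ?_, ?_, ?_, ?_, ?_, ?_⟩
  · obtain ⟨κ, h1, h2, h3, h4⟩ := MaxFilter.exists_kappa_twelve
    exact ⟨κ, MaxFilter.kappaEq_E₆ h1 h4, abs_lt.2 ⟨by linarith, by linarith⟩, h3⟩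
  · obtain ⟨κ, h1, h2, h3, h4⟩ := MaxFilter.exists_kappa_eighteen
    exact ⟨κ, MaxFilter.kappaEq_E₇ h1 h4, abs_lt.2 ⟨by linarith, by linarith⟩, h3⟩
  · obtain ⟨κ, h1, h2, h3, h4⟩ := MaxFilter.exists_kappa_thirty
    exact ⟨κ, MaxFilter.kappaEq_E₈ h1 h4, abs_lt.2 ⟨by linarith, by linarith⟩, h3⟩
  · obtain ⟨κ, h1, h2, h3, h4⟩ := MaxFilter.exists_kappa_twelve
    exact ⟨κ, MaxFilter.kappaEq_F₄ h1 h4, abs_lt.2 ⟨by linarith, by linarith⟩, h3⟩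
  · obtain ⟨κ, h1, h2, h3, h4⟩ := MaxFilter.exists_kappa_ten
    exact ⟨κ, MaxFilter.kappaEq_H₃ h1 h4, abs_lt.2 ⟨by linarith, by linarith⟩, h3⟩
  · obtain ⟨κ, h1, h2, h3, h4⟩ := MaxFilter.exists_kappa_thirty
    exact ⟨κ, MaxFilter.kappaEq_H₄ h1 h4, abs_lt.2 ⟨by linarith, by linarith⟩, h3⟩
  · obtain ⟨ε, hε, h⟩ := MaxFilter.exists_error_of_tendsto MaxFilter.tendsto_condNumber_A
    exact ⟨ε, hε, fun l hl => (MaxFilter.kappaEq_A hl).congr (h l hl)⟩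
  · obtain ⟨ε, hε, h⟩ := MaxFilter.exists_error_of_tendsto MaxFilter.tendsto_condNumber_B
    exact ⟨ε, hε, fun l hl => (MaxFilter.kappaEq_B hl).congr (h l (by omega))⟩
  · obtain ⟨ε, hε, h⟩ := MaxFilter.exists_error_of_tendsto MaxFilter.tendsto_condNumber_D
    exact ⟨ε, hε, fun l hl => (MaxFilter.kappaEq_D hl).congr (h l (by omega))⟩
  · obtain ⟨ε, hε, h⟩ := MaxFilter.exists_error_of_tendsto MaxFilter.tendsto_condNumber_I
    exact ⟨ε, hε, fun m hm => ⟨MaxFilter.kappaEq_I hm, h m (by omega)⟩⟩
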